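/- **Theorem (Two-line parking with screening).** Cars arrive at the vertices of $\mathbb Z$ according to independent Poisson processes of rate one; let $N_j(t)$ be the number of cars that have arrived at vertex $j$ up to time $t$. Let $m_j(t)\in\{0,1,2,3\}$ describe the parked cars at vertex $j$: $0$ = vacant, $1$ = occupied in the first line only, $2$ = occupied in the second line only, $3$ = occupied in both lines. At time $0$ all vertices are vacant. A car that arrives at vertex $k$ changes $m_k$ as follows, according to the triple $(m_{k-1},m_k,m_{k+1})$ just before its arrival: for $(0,0,0)$ the value $m_k$ becomes $1$; for $(1,0,0)$, $(0,0,1)$ and $(1,0,1)$ it becomes $2$; for $(0,1,0)$ it becomes $3$; in all other cases the car is discarded. (So cars in the second line block the access to the first line.) For $t\ge 0$ put $$D_t(s)=P(m_0(t)=s),\qquad D_t(0,1,0)=P(m_{-1}(t)=0,\,m_0(t)=1,\,m_1(t)=0),$$ $$f_t(s)=P(m_1(t)=s\mid N_0(t)=0)\ \ (s=0,1,2),\qquad R_t=P(m_1(t)=1,\,m_2(t)=0\mid N_0(t)=0).$$ Then all these functions are differentiable on $[0,\infty)$ (from the right at $t=0$), and for all $t\ge 0$ $$\begin{aligned} \tfrac{d}{dt}D_t(0)&=-(f_t(0)+f_t(1))^2e^{-t},\\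 \tfrac{d}{dt}D_t(1)&=f_t(0)^2e^{-t}-D_t(0,1,0),\\ \tfrac{d}{dt}D_t(2)&=(2f_t(0)f_t(1)+f_t(1)^2)e^{-t},\\ \tfrac{d}{dt}D_t(3)&=D_t(0,1,0), \end{aligned}$$ with $D_0(0)=1$ and $D_0(1)=D_0(2)=D_0(3)=0$; the vector $(f_t(0),f_t(1),f_t(2),R_t)$ obeys the linear system $$\begin{aligned} \tfrac{d}{dt}f_t(0)&=-f_t(0)e^{-t}-f_t(1)e^{-t},\\ \tfrac{d}{dt}f_t(1)&=f_t(0)e^{-t}-R_t,\\ \tfrac{d}{dt}f_t(2)&=f_t(1)e^{-t},\\ \tfrac{d}{dt}R_t&=f_t(0)(e^{-t}-te^{-2t})-f_t(1)\,t\,e^{-2t}-R_t, \end{aligned}$$ with $(f_0(0),f_0(1),f_0(2),R_0)=(1,0,0,0)$; and $$\tfrac{d}{dt}D_t(0,1,0)=f_t(0)^2e^{-t}-D_t(0,1,0)-2R_tf_t(0)e^{-t}-2R_tf_t(1)e^{-t},$$ with $D_0(0,1,0)=0$. -/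

import Mathlib

open MeasureTheory ProbabilityTheory Set Filter Topology
open scoped NNReal

noncomputable section

namespace Parking

/-- Joint occupation of the two lines at one vertex, read as binary digits: `0` vacant, `1` only the
first line is occupied, `2` only the second line is occupied, `3` both lines are occupied. -/
abbrev Spin := Fin 4

/-- A state of the parking process together with its arrivals: the occupation numbers `x.1 = m` and
the numbers `x.2 = N` of cars that have arrived (parked or discarded) at the vertices of `ℤ`.
It carries the product topology and the product σ-algebra of the discrete ones. -/
abbrev Config := (ℤ → Spin) × (ℤ → ℕ)

/-- The empty street before any arrival. -/
def emptyConfig : Config := (fun _ => 0, fun _ => 0)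

/-- The rate `c(s; a, b, d)` of the screening model, at which a vertex in state `b` whose left and
right neighbours are in states `a` and `d` changes to the state `s`. -/
def rateSc (s a b d : Spin) : ℝ :=
  if (s, a, b, d) ∈ ({
      -- a car parks in the first line
      (1, 0, 0, 0),
      -- a car parks in the second line, the vertex being vacant in the first line
      (2, 1, 0, 0), (2, 0, 0, 1), (2, 1, 0, 1),
      -- a car parks in the second line, the vertex being occupied in the first line
      (3, 0, 1, 0)} : Finset (Spin × Spin × Spin × Spin))
  then 1 else 0

/-- A car arrives at `k` and the occupation number at `k` becomes `s`. -/
def park (x : Config) (k : ℤ) (s : Spin) : Config :=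
  (Function.update x.1 k s, Function.update x.2 k (x.2 k + 1))

/-- A car arrives at `k` and is discarded. -/
def discard (x : Config) (k : ℤ) : Config :=
  (x.1, Function.update x.2 k (x.2 k + 1))

/-- The function `f` depends on finitely many vertices only. -/
def IsLocal (f : Config → ℝ) : Prop :=
  ∃ Λ : Finset ℤ, ∀ x y : Config,
    (∀ k ∈ Λ, x.1 k = y.1 k ∧ x.2 k = y.2 k) → f x = f y

/-- The generator of the screening model with its arrivals: cars arrive at every vertex `k` at rate
one, and park according to the rates `rateSc` or are otherwise discarded. For local `f` the sum over
`k` has only finitely many nonzero terms. If `f` depends on `m` only, the second summand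
vanishes. -/
def generatorSc (f : Config → ℝ) (x : Config) : ℝ :=
  ∑ᶠ k : ℤ,
    ((∑ s : Spin, rateSc s (x.1 (k - 1)) (x.1 k) (x.1 (k + 1)) * (f (park x k s) - f x))
      + (1 - ∑ s : Spin, rateSc s (x.1 (k - 1)) (x.1 k) (x.1 (k + 1)))
          * (f (discard x k) - f x))

/-- `X t = (m(t), N(t))` is a version of the screening parking process started from the empty
street, with the counting processes of its arrivals: an adapted càdlàg process solving the
martingale problem for the generator on bounded local functions. -/
structure IsScreeningProcess {Ω : Type*} {mΩ : MeasurableSpace Ω} (P : Measure Ω)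
    (ℱ : Filtration ℝ≥0 mΩ) (X : ℝ≥0 → Ω → Config) : Prop where
  adapted : ∀ t, Measurable[ℱ t] (X t)
  right_continuous : ∀ ω t, ContinuousWithinAt (fun s => X s ω) (Ici t) t
  left_limits : ∀ ω t, ∃ x, Tendsto (fun s => X s ω) (𝓝[<] t) (𝓝 x)
  initial : ∀ᵐ ω ∂P, X 0 ω = emptyConfig
  martingale : ∀ f : Config → ℝ, IsLocal f → (∃ C, ∀ x, |f x| ≤ C) →
    Martingale (fun (t : ℝ≥0) ω =>
      f (X t ω) - ∫ s in (0 : ℝ)..t, generatorSc f (X s.toNNReal ω)) ℱ P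

section Densities

variable {Ω : Type*} [MeasurableSpace Ω] (P : Measure Ω) (X : ℝ≥0 → Ω → Config)

/-- `D_t(s) = P(m₀(t) = s)`, for `t ≥ 0`. -/
def D (s : Spin) (t : ℝ) : ℝ :=
  P.real {ω | (X t.toNNReal ω).1 0 = s}

/-- `D_t(a, b, d) = P(m₋₁(t) = a, m₀(t) = b, m₁(t) = d)`, for `t ≥ 0`. -/
def D₃ (a b d : Spin) (t : ℝ) : ℝ :=
  P.real {ω | (X t.toNNReal ω).1 (-1) = a ∧ (X t.toNNReal ω).1 0 = b ∧ (X t.toNNReal ω).1 1 = d}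

/-- The event `N₀(t) = 0`. -/
def noArrival (t : ℝ) : Set Ω := {ω | (X t.toNNReal ω).2 0 = 0}

/-- The one-sided density `f_t(s) = P(m₁(t) = s | N₀(t) = 0)`, for `t ≥ 0`. -/
def f (s : Spin) (t : ℝ) : ℝ :=
  (P[|noArrival X t]).real {ω | (X t.toNNReal ω).1 1 = s}

/-- The one-sided density `R_t = P(m₁(t) = 1, m₂(t) = 0 | N₀(t) = 0)`, for `t ≥ 0`. -/
def R (t : ℝ) : ℝ :=
  (P[|noArrival X t]).real {ω | (X t.toNNReal ω).1 1 = 1 ∧ (X t.toNNReal ω).1 2 = 0}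

end Densities

end Parking

end

/-! A car at `k` acts on the configuration by a deterministic map `arrive k`, so the generator is
the sum over `k` of `f ∘ arrive k - f`. It preserves bounded local functions, and the martingale
problem then gives the forward equation (`hasDerivWithinAt_expect`): the expectation of `f` has as
derivative the expectation of the generator applied to `f`. These equations form an infinite
hierarchy, because an arrival brings in the neighbours of its vertex.

Two facts close it. A vertex changes only through its own arrivals, so no influence crosses a vertex
`c` without arrivals, and given that event the two sides of `c` are independent
(`expect_mul_mul_noCar`). Moreover, almost surely a vacant vertex with no neighbour in the second
line has had no arrival (`ae_regular`). Hence every filling of a vacant vertex happens on an event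
without arrivals, where probabilities factor into one-sided densities. The only other transition,
from `1` to `3`, is accounted for by the pattern `(0, 1, 0)` and its one-sided version `R`.

Independence and invariance under the symmetries of the line are both proved by uniqueness. The
defect vanishes at time zero and obeys a linear hierarchy whose coefficients grow only linearly in
the rank; a bounded solution of it is zero (`eq_zero_of_deriv_le_rank`). -/

namespace Parking

/-! ### Arrivals as deterministic maps -/

/-- The state of a vertex in state `b` with neighbours in states `a` and `d` after an arrival. -/
def nextSpin (a b d : Spin) : Spin :=
  if b = 0 then
    if a = 0 ∧ d = 0 then 1 else if (a = 0 ∨ a = 1) ∧ (d = 0 ∨ d = 1) then 2 else 0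
  else if a = 0 ∧ b = 1 ∧ d = 0 then 3 else b

/-- The configuration after an arrival at `k`. -/
def arrive (k : ℤ) (x : Config) : Config := park x k (nextSpin (x.1 (k - 1)) (x.1 k) (x.1 (k + 1)))

/-- Each neighbourhood admits at most one change of state, so the rates are the indicator of a
deterministic update; the finitely many cases are enumerated. -/
theorem rateSc_eq (s a b d : Spin) :
    rateSc s a b d = if s = nextSpin a b d ∧ s ≠ b then 1 else 0 := by
  have h : ∀ s a b d : Spin, ((s, a, b, d) ∈ ({(1, 0, 0, 0), (2, 1, 0, 0), (2, 0, 0, 1),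
      (2, 1, 0, 1), (3, 0, 1, 0)} : Finset (Spin × Spin × Spin × Spin))) ↔
      (s = nextSpin a b d ∧ s ≠ b) := by
    unfold nextSpin; decide
  unfold rateSc
  simp only [h]

theorem park_self (x : Config) (k : ℤ) : park x k (x.1 k) = discard x k := by
  simp [park, discard]

/-- A discarded car is the case in which `nextSpin` returns the current state, so parking and
discarding merge into one map applied at rate one. -/
theorem generatorSc_eq_finsum (f : Config → ℝ) (x : Config) :
    generatorSc f x = ∑ᶠ k : ℤ, (f (arrive k x) - f x) := by
  unfold generatorSc
  congr 1
  ext k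
  by_cases h : nextSpin (x.1 (k - 1)) (x.1 k) (x.1 (k + 1)) = x.1 k
  · have h0 : ∀ s, rateSc s (x.1 (k - 1)) (x.1 k) (x.1 (k + 1)) = 0 := by
      intro s
      rw [rateSc_eq, h, if_neg (by tauto)]
    simp [h0, arrive, h, park_self]
  · have h0 : ∀ s, rateSc s (x.1 (k - 1)) (x.1 k) (x.1 (k + 1)) =
        if s = nextSpin (x.1 (k - 1)) (x.1 k) (x.1 (k + 1)) then 1 else 0 := by
      intro s
      rw [rateSc_eq]
      congr 1
      simp only [eq_iff_iff, and_iff_left_iff_imp]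
      rintro rfl
      exact h
    simp [h0, arrive]

theorem arrive_fst_of_ne {j k : ℤ} (h : j ≠ k) (x : Config) : (arrive k x).1 j = x.1 j := by
  simp [arrive, park, h]

theorem arrive_snd_of_ne {j k : ℤ} (h : j ≠ k) (x : Config) : (arrive k x).2 j = x.2 j := by
  simp [arrive, park, h]

theorem arrive_fst_self (k : ℤ) (x : Config) :
    (arrive k x).1 k = nextSpin (x.1 (k - 1)) (x.1 k) (x.1 (k + 1)) := by
  simp [arrive, park]

theorem arrive_snd_self (k : ℤ) (x : Config) : (arrive k x).2 k = x.2 k + 1 := by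
  simp [arrive, park]

/-! ### Bounded local functions -/

/-- The function `f` depends on the vertices of `Λ` only. -/
def DependsOnVertices (Λ : Finset ℤ) (f : Config → ℝ) : Prop :=
  ∀ x y : Config, (∀ k ∈ Λ, x.1 k = y.1 k ∧ x.2 k = y.2 k) → f x = f y

theorem DependsOnVertices.mono {Λ Λ' : Finset ℤ} {f : Config → ℝ} (hf : DependsOnVertices Λ f)
    (h : Λ ⊆ Λ') : DependsOnVertices Λ' f :=
  fun x y hxy => hf x y fun k hk => hxy k (h hk)

theorem DependsOnVertices.arrive_eq {Λ : Finset ℤ} {f : Config → ℝ} (hf : DependsOnVertices Λ f)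
    {k : ℤ} (hk : k ∉ Λ) (x : Config) : f (arrive k x) = f x :=
  hf _ _ fun j hj => by
    have : j ≠ k := fun h => hk (h ▸ hj)
    exact ⟨arrive_fst_of_ne this x, arrive_snd_of_ne this x⟩

theorem DependsOnVertices.comp_arrive {Λ : Finset ℤ} {f : Config → ℝ}
    (hf : DependsOnVertices Λ f) (k : ℤ) :
    DependsOnVertices (insert (k - 1) (insert (k + 1) (insert k Λ))) (fun x => f (arrive k x)) := by
  intro x y hxy
  apply hf
  intro j hj
  by_cases h : j = k
  · subst h
    rw [arrive_fst_self, arrive_fst_self, arrive_snd_self, arrive_snd_self,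
      (hxy (j - 1) (by simp)).1, (hxy j (by simp)).1, (hxy (j + 1) (by simp)).1,
      (hxy j (by simp)).2]
    exact ⟨rfl, rfl⟩
  · rw [arrive_fst_of_ne h, arrive_fst_of_ne h, arrive_snd_of_ne h, arrive_snd_of_ne h]
    exact hxy j (by simp [hj])

theorem DependsOnVertices.mul {Λ : Finset ℤ} {f g : Config → ℝ} (hf : DependsOnVertices Λ f)
    (hg : DependsOnVertices Λ g) : DependsOnVertices Λ (fun x => f x * g x) :=
  fun x y h => by simp only [hf x y h, hg x y h]

theorem DependsOnVertices.add {Λ : Finset ℤ} {f g : Config → ℝ} (hf : DependsOnVertices Λ f)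
    (hg : DependsOnVertices Λ g) : DependsOnVertices Λ (fun x => f x + g x) :=
  fun x y h => by simp only [hf x y h, hg x y h]

theorem DependsOnVertices.sub {Λ : Finset ℤ} {f g : Config → ℝ} (hf : DependsOnVertices Λ f)
    (hg : DependsOnVertices Λ g) : DependsOnVertices Λ (fun x => f x - g x) :=
  fun x y h => by simp only [hf x y h, hg x y h]

theorem generatorSc_eq_sum {Λ : Finset ℤ} {f : Config → ℝ} (hf : DependsOnVertices Λ f)
    (x : Config) : generatorSc f x = ∑ k ∈ Λ, (f (arrive k x) - f x) := by
  rw [generatorSc_eq_finsum]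
  apply finsum_eq_sum_of_support_subset
  intro k hk
  by_contra h
  exact hk (by simp [hf.arrive_eq h])

theorem dependsOnVertices_sum {Λ : Finset ℤ} {ι : Type*} (s : Finset ι) {f : ι → Config → ℝ}
    (hf : ∀ i ∈ s, DependsOnVertices Λ (f i)) :
    DependsOnVertices Λ (fun x => ∑ i ∈ s, f i x) :=
  fun x y h => Finset.sum_congr rfl fun i hi => hf i hi x y h

/-- Bounded local functions. -/
def BddLocal (f : Config → ℝ) : Prop := IsLocal f ∧ ∃ C, ∀ x, |f x| ≤ C

theorem DependsOnVertices.isLocal {Λ : Finset ℤ} {f : Config → ℝ} (hf : DependsOnVertices Λ f) :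
    IsLocal f := ⟨Λ, hf⟩

theorem BddLocal.add {f g : Config → ℝ} (hf : BddLocal f) (hg : BddLocal g) :
    BddLocal (fun x => f x + g x) := by
  obtain ⟨⟨Λ, hΛ⟩, C, hC⟩ := hf
  obtain ⟨⟨Λ', hΛ'⟩, C', hC'⟩ := hg
  refine ⟨⟨Λ ∪ Λ', (DependsOnVertices.mono hΛ Finset.subset_union_left).add
    (DependsOnVertices.mono hΛ' Finset.subset_union_right)⟩, C + C', fun x => ?_⟩
  exact (abs_add_le _ _).trans (add_le_add (hC x) (hC' x))

theorem BddLocal.sub {f g : Config → ℝ} (hf : BddLocal f) (hg : BddLocal g) :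
    BddLocal (fun x => f x - g x) := by
  obtain ⟨⟨Λ, hΛ⟩, C, hC⟩ := hf
  obtain ⟨⟨Λ', hΛ'⟩, C', hC'⟩ := hg
  refine ⟨⟨Λ ∪ Λ', (DependsOnVertices.mono hΛ Finset.subset_union_left).sub
    (DependsOnVertices.mono hΛ' Finset.subset_union_right)⟩, C + C', fun x => ?_⟩
  exact (abs_sub _ _).trans (add_le_add (hC x) (hC' x))

theorem BddLocal.mul {f g : Config → ℝ} (hf : BddLocal f) (hg : BddLocal g) :
    BddLocal (fun x => f x * g x) := by
  obtain ⟨⟨Λ, hΛ⟩, C, hC⟩ := hf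
  obtain ⟨⟨Λ', hΛ'⟩, C', hC'⟩ := hg
  refine ⟨⟨Λ ∪ Λ', (DependsOnVertices.mono hΛ Finset.subset_union_left).mul
    (DependsOnVertices.mono hΛ' Finset.subset_union_right)⟩, C * C', fun x => ?_⟩
  rw [abs_mul]
  exact mul_le_mul (hC x) (hC' x) (abs_nonneg _) ((abs_nonneg _).trans (hC x))

theorem BddLocal.comp_arrive {f : Config → ℝ} (hf : BddLocal f) (k : ℤ) :
    BddLocal (fun x => f (arrive k x)) := by
  obtain ⟨⟨Λ, hΛ⟩, C, hC⟩ := hf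
  exact ⟨⟨_, DependsOnVertices.comp_arrive hΛ k⟩, C, fun x => hC _⟩

theorem BddLocal.sum {ι : Type*} (s : Finset ι) {f : ι → Config → ℝ}
    (hf : ∀ i, BddLocal (f i)) : BddLocal (fun x => ∑ i ∈ s, f i x) := by
  choose h C hC using hf
  choose Λ hΛ using h
  refine ⟨⟨s.biUnion Λ, dependsOnVertices_sum s fun i hi =>
    DependsOnVertices.mono (hΛ i) (Finset.subset_biUnion_of_mem Λ hi)⟩, ∑ i ∈ s, C i, fun x => ?_⟩
  exact (Finset.abs_sum_le_sum_abs _ _).trans (Finset.sum_le_sum fun i _ => hC i x)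

theorem BddLocal.generatorSc {f : Config → ℝ} (hf : BddLocal f) : BddLocal (generatorSc f) := by
  obtain ⟨Λ, hΛ⟩ := hf.1
  have : Parking.generatorSc f = fun x => ∑ k ∈ Λ, (f (arrive k x) - f x) :=
    funext (generatorSc_eq_sum hΛ)
  rw [this]
  exact BddLocal.sum Λ fun k => (hf.comp_arrive k).sub hf

/-- Through finitely many discrete coordinates any function is continuous and measurable, so local
functions inherit both. -/
theorem IsLocal.exists_factor {f : Config → ℝ} (hf : IsLocal f) :
    ∃ (Λ : Finset ℤ) (g : (Λ → Spin) × (Λ → ℕ) → ℝ),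
      f = fun x => g (fun k => x.1 k, fun k => x.2 k) := by
  classical
  obtain ⟨Λ, hΛ⟩ := hf
  refine ⟨Λ, fun y => f (fun k => if h : k ∈ Λ then y.1 ⟨k, h⟩ else 0,
    fun k => if h : k ∈ Λ then y.2 ⟨k, h⟩ else 0), funext fun x => hΛ _ _ fun k hk => ?_⟩
  simp [hk]

theorem IsLocal.continuous {f : Config → ℝ} (hf : IsLocal f) : Continuous f := by
  obtain ⟨Λ, g, rfl⟩ := hf.exists_factor
  exact (continuous_of_discreteTopology (f := g)).comp (by fun_prop)

theorem IsLocal.measurable {f : Config → ℝ} (hf : IsLocal f) : Measurable f := by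
  obtain ⟨Λ, g, rfl⟩ := hf.exists_factor
  exact (measurable_of_countable g).comp (by fun_prop)

/-! ### Expectations and the forward equation -/

section Expectation

variable {Ω : Type*} {mΩ : MeasurableSpace Ω}

/-- Evaluation at the next point of the grid of mesh `1 / (n + 1)` is jointly measurable, and by
right continuity it converges to `Y`. Joint measurability is what Fubini needs in `expect_eq`. -/
theorem measurable_uncurry_of_rightContinuous {Y : ℝ≥0 → Ω → ℝ} (hm : ∀ t, Measurable (Y t))
    (hc : ∀ ω t, ContinuousWithinAt (fun s => Y s ω) (Ici t) t) :
    Measurable (Function.uncurry Y) := by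
  have hr : ∀ t : ℝ≥0, Tendsto (fun n : ℕ => (⌊((n : ℝ≥0) + 1) * t⌋₊ + 1 : ℝ≥0) / ((n : ℝ≥0) + 1))
      atTop (𝓝[Ici t] t) := fun t => by
    have hlt : ∀ n : ℕ, t ≤ (⌊((n : ℝ≥0) + 1) * t⌋₊ + 1 : ℝ≥0) / ((n : ℝ≥0) + 1) := fun n => by
      rw [le_div_iff₀ (by positivity), mul_comm]
      exact (Nat.lt_floor_add_one _).le
    have hle : ∀ n : ℕ, (⌊((n : ℝ≥0) + 1) * t⌋₊ + 1 : ℝ≥0) / ((n : ℝ≥0) + 1) ≤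
        t + 1 / ((n : ℝ≥0) + 1) := fun n => by
      have h : t + 1 / ((n : ℝ≥0) + 1) = (((n : ℝ≥0) + 1) * t + 1) / ((n : ℝ≥0) + 1) := by
        field_simp
      rw [h]
      gcongr
      exact Nat.floor_le (by positivity)
    refine tendsto_nhdsWithin_iff.2 ⟨?_, Eventually.of_forall hlt⟩
    refine tendsto_of_tendsto_of_tendsto_of_le_of_le tendsto_const_nhds ?_ hlt hle
    simpa using (tendsto_const_nhds (x := t)).add
      (tendsto_one_div_add_atTop_nhds_zero_nat (𝕜 := ℝ≥0))
  have hmeas : ∀ n : ℕ, Measurable fun p : ℝ≥0 × Ω =>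
      Y ((⌊((n : ℝ≥0) + 1) * p.1⌋₊ + 1 : ℝ≥0) / ((n : ℝ≥0) + 1)) p.2 := fun n => by
    have key : ∀ (Z : ℕ → Ω → ℝ) (φ : ℝ≥0 → ℕ), (∀ m, Measurable (Z m)) → Measurable φ →
        Measurable fun p : ℝ≥0 × Ω => Z (φ p.1) p.2 := fun Z φ hZ hφ =>
      (measurable_from_prod_countable_right (f := Function.uncurry Z) hZ).comp
        ((hφ.comp measurable_fst).prodMk measurable_snd)
    exact key (fun m => Y ((m + 1 : ℝ≥0) / ((n : ℝ≥0) + 1))) (fun t => ⌊((n : ℝ≥0) + 1) * t⌋₊)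
      (fun m => hm _) (Nat.measurable_floor.comp (measurable_const_mul _))
  refine measurable_of_tendsto_metrizable hmeas (tendsto_pi_nhds.2 fun p => ?_)
  exact (hc p.2 p.1).tendsto.comp (hr p.1)

/-- The expectation of `f` at time `t`. -/
noncomputable def expect (P : Measure Ω) (X : ℝ≥0 → Ω → Config) (f : Config → ℝ) (t : ℝ) : ℝ :=
  ∫ ω, f (X t.toNNReal ω) ∂P

variable {P : Measure Ω} {ℱ : Filtration ℝ≥0 mΩ}
  {X : ℝ≥0 → Ω → Config}

theorem abs_expect_le [IsProbabilityMeasure P] {f : Config → ℝ} {C : ℝ}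
    (hC : ∀ x, |f x| ≤ C) (t : ℝ) : |expect P X f t| ≤ C := by
  simpa [expect] using norm_integral_le_of_norm_le_const (μ := P)
    (f := fun ω => f (X t.toNNReal ω)) (ae_of_all _ fun ω => hC (X t.toNNReal ω))

namespace IsScreeningProcess

theorem measurable (hX : IsScreeningProcess P ℱ X) (t : ℝ≥0) : Measurable (X t) :=
  (hX.adapted t).mono (ℱ.le t) le_rfl

theorem measurable_comp (hX : IsScreeningProcess P ℱ X) {f : Config → ℝ} (hf : IsLocal f)
    (t : ℝ≥0) : Measurable (fun ω => f (X t ω)) :=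
  hf.measurable.comp (hX.measurable t)

theorem measurable_uncurry (hX : IsScreeningProcess P ℱ X) {f : Config → ℝ} (hf : IsLocal f) :
    Measurable (Function.uncurry fun (t : ℝ) ω => f (X t.toNNReal ω)) := by
  have h := measurable_uncurry_of_rightContinuous (Y := fun t ω => f (X t ω))
    (hX.measurable_comp hf)
    (fun ω t => (hf.continuous.tendsto _).comp (hX.right_continuous ω t))
  exact h.comp ((measurable_real_toNNReal.comp measurable_fst).prodMk measurable_snd)

variable [IsProbabilityMeasure P]

theorem integrable (hX : IsScreeningProcess P ℱ X) {f : Config → ℝ} (hf : BddLocal f)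
    (t : ℝ≥0) : Integrable (fun ω => f (X t ω)) P := by
  obtain ⟨C, hC⟩ := hf.2
  exact Integrable.of_bound (hX.measurable_comp hf.1 t).aestronglyMeasurable C
    (ae_of_all _ fun ω => hC _)

theorem measurable_expect (hX : IsScreeningProcess P ℱ X) {f : Config → ℝ} (hf : IsLocal f) :
    Measurable (expect P X f) :=
  ((hX.measurable_uncurry hf).stronglyMeasurable.integral_prod_right).measurable

theorem intervalIntegrable_expect (hX : IsScreeningProcess P ℱ X) {f : Config → ℝ}
    (hf : BddLocal f) (a b : ℝ) : IntervalIntegrable (expect P X f) volume a b := by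
  obtain ⟨C, hC⟩ := hf.2
  refine (intervalIntegrable_const (c := C)).mono_fun
    (hX.measurable_expect hf.1).aestronglyMeasurable (ae_of_all _ fun t => ?_)
  exact (abs_expect_le hC t).trans (le_abs_self _)

/-- Dynkin's formula: the martingale has the same mean at times `0` and `t`, and Fubini moves the
expectation inside the time integral. -/
theorem expect_eq (hX : IsScreeningProcess P ℱ X) {f : Config → ℝ} (hf : BddLocal f) {t : ℝ}
    (ht : 0 ≤ t) :
    expect P X f t = f emptyConfig + ∫ s in (0 : ℝ)..t, expect P X (generatorSc f) s := by
  have hM := hX.martingale f hf.1 hf.2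
  have hg := hf.generatorSc
  obtain ⟨C, hC⟩ := hg.2
  have h1 := hM.setIntegral_eq (i := 0) (j := t.toNNReal) bot_le MeasurableSet.univ
  have : IsFiniteMeasure (volume.restrict (uIoc 0 t)) := ⟨by simp [uIoc]⟩
  have hint : Integrable (Function.uncurry fun (s : ℝ) ω => generatorSc f (X s.toNNReal ω))
      ((volume.restrict (uIoc 0 t)).prod P) := by
    refine Integrable.of_bound (hX.measurable_uncurry hg.1).aestronglyMeasurable C
      (ae_of_all _ fun p => hC _)
  have hswap := intervalIntegral_integral_swap hint
  have h0 : ∫ ω, f (X 0 ω) ∂P = f emptyConfig := by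
    rw [integral_congr_ae (g := fun _ => f emptyConfig)
      (hX.initial.mono fun ω h => by simp only [h])]
    simp
  -- The time integral is the difference of `f (X t)` and the martingale, both integrable.
  have hi : Integrable (fun ω => ∫ s in (0 : ℝ)..t, generatorSc f (X s.toNNReal ω)) P := by
    have := (hX.integrable hf t.toNNReal).sub (hM.integrable t.toNNReal)
    simpa [Real.coe_toNNReal _ ht, Pi.sub_def] using this
  simp only [setIntegral_univ, NNReal.coe_zero, intervalIntegral.integral_same, sub_zero,
    Real.coe_toNNReal _ ht] at h1
  rw [integral_sub (hX.integrable hf _) hi, h0, ← hswap] at h1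
  simp only [expect]
  linarith

theorem expect_of_nonpos (hX : IsScreeningProcess P ℱ X) {f : Config → ℝ} (hf : BddLocal f)
    {t : ℝ} (ht : t ≤ 0) : expect P X f t = f emptyConfig := by
  have h : expect P X f t = expect P X f 0 := by
    simp [expect, Real.toNNReal_of_nonpos ht]
  rw [h, hX.expect_eq hf le_rfl, intervalIntegral.integral_same, add_zero]

theorem expect_zero (hX : IsScreeningProcess P ℱ X) {f : Config → ℝ} (hf : BddLocal f) :
    expect P X f 0 = f emptyConfig := hX.expect_of_nonpos hf le_rfl

/-- Negative times are clamped to `0` by `toNNReal`, so continuity holds on the whole line. Applied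
to `generatorSc f`, this makes the integrand of Dynkin's formula continuous, hence the formula
differentiable. -/
theorem continuous_expect (hX : IsScreeningProcess P ℱ X) {f : Config → ℝ} (hf : BddLocal f) :
    Continuous (expect P X f) := by
  have h : expect P X f = fun t => f emptyConfig +
      ∫ s in (0 : ℝ)..(max t 0), expect P X (generatorSc f) s := by
    ext t
    rcases le_total 0 t with ht | ht
    · rw [max_eq_left ht, hX.expect_eq hf ht]
    · rw [max_eq_right ht, intervalIntegral.integral_same, hX.expect_of_nonpos hf ht, add_zero]
  rw [h]
  exact continuous_const.add ((intervalIntegral.continuous_primitive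
    (hX.intervalIntegrable_expect hf.generatorSc) 0).comp (continuous_id.max continuous_const))

theorem hasDerivWithinAt_expect (hX : IsScreeningProcess P ℱ X) {f : Config → ℝ}
    (hf : BddLocal f) {t : ℝ} (ht : 0 ≤ t) :
    HasDerivWithinAt (expect P X f) (expect P X (generatorSc f) t) (Ici 0) t := by
  have hc := hX.continuous_expect hf.generatorSc
  have h := (intervalIntegral.integral_hasDerivAt_right (hc.intervalIntegrable 0 t)
    (hc.stronglyMeasurableAtFilter _ _) hc.continuousAt).const_add (f emptyConfig)
  exact h.hasDerivWithinAt.congr (fun s hs => hX.expect_eq hf hs) (hX.expect_eq hf ht)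

theorem expect_sub (hX : IsScreeningProcess P ℱ X) {f g : Config → ℝ} (hf : BddLocal f)
    (hg : BddLocal g) (t : ℝ) :
    expect P X (fun x => f x - g x) t = expect P X f t - expect P X g t :=
  integral_sub (hX.integrable hf _) (hX.integrable hg _)

theorem expect_sum (hX : IsScreeningProcess P ℱ X) {ι : Type*} (s : Finset ι)
    {f : ι → Config → ℝ} (hf : ∀ i, BddLocal (f i)) (t : ℝ) :
    expect P X (fun x => ∑ i ∈ s, f i x) t = ∑ i ∈ s, expect P X (f i) t :=
  integral_finsetSum _ fun i _ => hX.integrable (hf i) _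

theorem expect_generatorSc (hX : IsScreeningProcess P ℱ X) {Λ : Finset ℤ} {f : Config → ℝ}
    (hΛ : DependsOnVertices Λ f) (hf : BddLocal f) (t : ℝ) :
    expect P X (generatorSc f) t =
      ∑ k ∈ Λ, (expect P X (fun x => f (arrive k x)) t - expect P X f t) := by
  rw [funext (generatorSc_eq_sum hΛ), hX.expect_sum _ fun k => (hf.comp_arrive k).sub hf]
  exact Finset.sum_congr rfl fun k _ => hX.expect_sub (hf.comp_arrive k) hf t

/-- A nonnegative local function which no arrival can increase and which vanishes at the empty
street vanishes along the process. -/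
theorem expect_eq_zero_of_arrive_le (hX : IsScreeningProcess P ℱ X) {f : Config → ℝ}
    (hf : BddLocal f) (h0 : ∀ x, 0 ≤ f x) (hle : ∀ k x, f (arrive k x) ≤ f x)
    (he : f emptyConfig = 0) {t : ℝ} (ht : 0 ≤ t) : expect P X f t = 0 := by
  refine le_antisymm ?_ (integral_nonneg fun ω => h0 _)
  obtain ⟨Λ, hΛ⟩ := hf.1
  rw [hX.expect_eq hf ht, he, zero_add]
  rw [intervalIntegral.integral_of_le ht]
  refine integral_nonpos fun s => ?_
  refine integral_nonpos fun ω => ?_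
  change generatorSc f _ ≤ 0
  rw [generatorSc_eq_sum hΛ]
  exact Finset.sum_nonpos fun k _ => sub_nonpos.2 (hle k _)

theorem ae_eq_zero_of_arrive_le (hX : IsScreeningProcess P ℱ X) {f : Config → ℝ}
    (hf : BddLocal f) (h0 : ∀ x, 0 ≤ f x) (hle : ∀ k x, f (arrive k x) ≤ f x)
    (he : f emptyConfig = 0) (t : ℝ≥0) : ∀ᵐ ω ∂P, f (X t ω) = 0 := by
  have h := hX.expect_eq_zero_of_arrive_le hf h0 hle he t.coe_nonneg
  simp only [expect, Real.toNNReal_coe] at h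
  exact (integral_eq_zero_iff_of_nonneg (fun ω => h0 _) (hX.integrable hf t)).1 h

end IsScreeningProcess

end Expectation

/-! ### Uniqueness for infinite linear hierarchies -/

/-- A uniformly bounded solution of an infinite linear system with zero initial values vanishes, if
the derivatives of the members of rank `n` are bounded by `K * (n + 1)` times the largest member of rank
`n + 1`. -/
theorem eq_zero_of_deriv_le_rank {ι : Type*} (S : ℕ → Set ι) (u : ι → ℝ → ℝ) {C K : ℝ}
    (hK : 0 < K) (hC : ∀ n, ∀ i ∈ S n, ∀ t, |u i t| ≤ C) (hc : ∀ n, ∀ i ∈ S n, Continuous (u i))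
    (h0 : ∀ n, ∀ i ∈ S n, u i 0 = 0)
    (hd : ∀ n, ∀ i ∈ S n, ∀ t, 0 ≤ t → ∃ d, HasDerivWithinAt (u i) d (Ici t) t ∧
      ∀ B, (∀ j ∈ S (n + 1), |u j t| ≤ B) → |d| ≤ K * (n + 1) * B)
    (n : ℕ) (i : ι) (hi : i ∈ S n) (t : ℝ) (ht : 0 ≤ t) : u i t = 0 := by
  -- Integrating the differential inequality `k` times from `T` multiplies the a priori bound `C` by
  -- `(K * s) ^ k / k!` and by the coefficients `(n + 1) * ... * (n + k)`.
  have key : ∀ T, 0 ≤ T → (∀ n, ∀ i ∈ S n, u i T = 0) → ∀ k n, ∀ i ∈ S n, ∀ s, 0 ≤ s →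
      |u i (T + s)| ≤ C * (K * s) ^ k * ((n + 1).ascFactorial k / k.factorial : ℝ) := by
    intro T hT hT0 k
    induction k with
    | zero => intro n i hi s _; simpa using hC n i hi (T + s)
    | succ k ih =>
      intro n i hi s hs
      choose! d hd1 hd2 using hd n i hi
      have hB : ∀ x : ℝ, HasDerivAt (fun x : ℝ => C * (K * x) ^ (k + 1) *
          ((n + 1).ascFactorial (k + 1) / (k + 1).factorial : ℝ))
          (C * ((k + 1) * (K * x) ^ k * K) *
            ((n + 1).ascFactorial (k + 1) / (k + 1).factorial : ℝ)) x := by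
        intro x
        have := (((hasDerivAt_id x).const_mul K).fun_pow (k + 1)).const_mul C
        have := this.mul_const ((n + 1).ascFactorial (k + 1) / (k + 1).factorial : ℝ)
        simpa using this
      refine image_norm_le_of_norm_deriv_right_le_deriv_boundary (a := 0) (b := s)
        (f := fun x => u i (T + x)) (f' := fun x => d (T + x))
        ((hc n i hi).comp (continuous_const.add continuous_id)).continuousOn ?_ ?_ hB ?_
        ⟨hs, le_rfl⟩
      · intro x hx
        have h1 := hd1 (T + x) (add_nonneg hT hx.1)
        have h2 : HasDerivWithinAt (fun x => T + x) 1 (Ici x) x :=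
          ((hasDerivAt_id x).const_add T).hasDerivWithinAt
        have h3 := h1.scomp x h2 (fun y hy => add_le_add_right (mem_Ici.1 hy) T)
        rwa [one_smul] at h3
      · simp [hT0 n i hi]
      · intro x hx
        refine (hd2 (T + x) (add_nonneg hT hx.1) _ fun j hj => ih (n + 1) j hj x hx.1).trans
          (le_of_eq ?_)
        rw [Nat.ascFactorial_succ, ← Nat.succ_ascFactorial, Nat.factorial_succ]
        push_cast
        field_simp
  -- The quotient in `key` is a binomial coefficient, at most `2 ^ (n + k)`, so for `K * s ≤ 1 / 4`
  -- the bound is at most `C * 2 ^ n * (1 / 2) ^ k` and tends to `0`. The length `1 / (4 * K)`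
  -- depends neither on `n` nor on `T`, so finitely many such steps reach any time.
  have step : ∀ T, 0 ≤ T → (∀ n, ∀ i ∈ S n, u i T = 0) → ∀ s, 0 ≤ s → s ≤ 1 / (4 * K) →
      ∀ n, ∀ i ∈ S n, u i (T + s) = 0 := by
    intro T hT hT0 s hs hsK n i hi
    have hCn : 0 ≤ C := (abs_nonneg _).trans (hC n i hi 0)
    have hKs : K * s ≤ 1 / 4 := by
      have := mul_le_mul_of_nonneg_left hsK hK.le
      refine this.trans (le_of_eq (by field_simp))
    have hlim : Tendsto (fun k : ℕ => C * 2 ^ n * (1 / 2 : ℝ) ^ k) atTop (𝓝 0) := by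
      simpa using (tendsto_pow_atTop_nhds_zero_of_lt_one (r := (1 / 2 : ℝ)) (by norm_num)
        (by norm_num)).const_mul (C * 2 ^ n)
    have hle : |u i (T + s)| ≤ 0 := by
      refine ge_of_tendsto hlim (Eventually.of_forall fun k => ?_)
      refine (key T hT hT0 k n i hi s hs).trans ?_
      have hb : ((n + 1).ascFactorial k / k.factorial : ℝ) ≤ 2 ^ (n + k) := by
        rw [div_le_iff₀ (by positivity)]
        have h2 := Nat.ascFactorial_eq_factorial_mul_choose n k
        have h3 : (n + k).choose k ≤ 2 ^ (n + k) := Nat.choose_le_two_pow _ _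
        have : (n + 1).ascFactorial k ≤ 2 ^ (n + k) * k.factorial := by
          calc _ = k.factorial * (n + k).choose k := h2
            _ ≤ k.factorial * 2 ^ (n + k) := Nat.mul_le_mul_left _ h3
            _ = _ := mul_comm _ _
        exact_mod_cast this
      calc C * (K * s) ^ k * ((n + 1).ascFactorial k / k.factorial : ℝ)
          ≤ C * (1 / 4) ^ k * 2 ^ (n + k) := by gcongr
        _ = C * 2 ^ n * (1 / 2 : ℝ) ^ k := by
          rw [pow_add, show (1 / 4 : ℝ) = 1 / 2 * (1 / 2) by norm_num, mul_pow]
          have : (1 / 2 : ℝ) ^ k * 2 ^ k = 1 := by rw [← mul_pow]; norm_num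
          linear_combination C * 2 ^ n * (1 / 2 : ℝ) ^ k * this
    exact abs_nonpos_iff.1 hle
  have hKpos : 0 < 1 / (4 * K) := by positivity
  have grid : ∀ m : ℕ, ∀ n, ∀ i ∈ S n, u i (m * (1 / (4 * K))) = 0 := by
    intro m
    induction m with
    | zero => simpa using h0
    | succ m ih =>
      have := step _ (by positivity) ih _ hKpos.le le_rfl
      simpa [add_mul] using this
  have hfl := Nat.floor_le (div_nonneg ht hKpos.le)
  have hlt := Nat.lt_floor_add_one (t / (1 / (4 * K)))
  rw [le_div_iff₀ hKpos] at hfl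
  rw [div_lt_iff₀ hKpos] at hlt
  have := step _ (by positivity) (grid ⌊t / (1 / (4 * K))⌋₊)
    (t - ⌊t / (1 / (4 * K))⌋₊ * (1 / (4 * K))) (by linarith) (by linarith) n i hi
  simpa using this

theorem eq_mul_exp_of_hasDerivWithinAt {u : ℝ → ℝ} {a : ℝ}
    (hu : ∀ t, 0 ≤ t → HasDerivWithinAt u (-(a * u t)) (Ici 0) t) {t : ℝ} (ht : 0 ≤ t) :
    u t = u 0 * Real.exp (-(a * t)) := by
  have hd : ∀ s, 0 ≤ s →
      HasDerivWithinAt (fun s => u s * Real.exp (a * s)) 0 (Ici 0) s := fun s hs => by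
    have h1 : HasDerivWithinAt (fun s => Real.exp (a * s)) (Real.exp (a * s) * (a * 1)) (Ici 0) s :=
      ((hasDerivAt_id s).const_mul a).exp.hasDerivWithinAt
    exact ((hu s hs).mul h1).congr_deriv (by ring)
  have h := constant_of_has_deriv_right_zero (a := 0) (b := t)
    (fun s hs => ((hd s hs.1).mono Icc_subset_Ici_self).continuousWithinAt)
    (fun s hs => (hd s hs.1).mono (Ici_subset_Ici.2 hs.1)) t ⟨ht, le_rfl⟩
  simp only [mul_zero, Real.exp_zero, mul_one] at h
  rw [← h, mul_assoc, ← Real.exp_add, add_neg_cancel, Real.exp_zero, mul_one]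

/-! ### Symmetries of the line -/

/-- Relabelling of the vertices. -/
def relabel (φ : ℤ → ℤ) (x : Config) : Config := (x.1 ∘ φ, x.2 ∘ φ)

/-- `φ` maps neighbours to neighbours. -/
def PreservesNeighbours (φ : ℤ → ℤ) : Prop :=
  ∀ k, (φ (k - 1) = φ k - 1 ∧ φ (k + 1) = φ k + 1) ∨ (φ (k - 1) = φ k + 1 ∧ φ (k + 1) = φ k - 1)

theorem nextSpin_comm (a b d : Spin) : nextSpin a b d = nextSpin d b a := by
  revert a b d; unfold nextSpin; decide

/-- The parking rule reads only the neighbours and is symmetric in them, so translations and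
reflections intertwine the arrivals and hence commute with the generator. -/
theorem arrive_relabel (φ : ℤ ≃ ℤ) (hφ : PreservesNeighbours φ) (k : ℤ) (x : Config) :
    arrive k (relabel φ x) = relabel φ (arrive (φ k) x) := by
  have h : nextSpin (x.1 (φ (k - 1))) (x.1 (φ k)) (x.1 (φ (k + 1))) =
      nextSpin (x.1 (φ k - 1)) (x.1 (φ k)) (x.1 (φ k + 1)) := by
    rcases hφ k with ⟨h1, h2⟩ | ⟨h1, h2⟩
    · rw [h1, h2]
    · rw [h1, h2, nextSpin_comm]
  apply Prod.ext <;> funext j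
  · by_cases hj : j = k
    · subst hj
      simp only [relabel, Function.comp, arrive_fst_self, h]
    · rw [arrive_fst_of_ne hj]
      simp only [relabel, Function.comp]
      rw [arrive_fst_of_ne (φ.injective.ne hj)]
  · by_cases hj : j = k
    · subst hj
      simp only [relabel, Function.comp, arrive_snd_self]
    · rw [arrive_snd_of_ne hj]
      simp only [relabel, Function.comp]
      rw [arrive_snd_of_ne (φ.injective.ne hj)]

theorem DependsOnVertices.comp_relabel {Λ : Finset ℤ} {f : Config → ℝ}
    (hf : DependsOnVertices Λ f) (φ : ℤ ≃ ℤ) :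
    DependsOnVertices (Λ.map φ.toEmbedding) (fun x => f (relabel φ x)) :=
  fun _ _ h => hf _ _ fun k hk => h (φ k) (Finset.mem_map_of_mem _ hk)

/-- An arrival adds at most two vertices. This keeps the number of terms of the generator linear in
the rank, as the uniqueness argument requires. -/
theorem card_insert_neighbours_le {Λ : Finset ℤ} {k : ℤ} (hk : k ∈ Λ) :
    (insert (k - 1) (insert (k + 1) (insert k Λ))).card ≤ Λ.card + 2 := by
  rw [Finset.insert_eq_of_mem hk]
  exact (Finset.card_insert_le _ _).trans (Nat.succ_le_succ (Finset.card_insert_le _ _))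

theorem abs_sum_sub_le {ι : Type*} (s : Finset ι) {a b : ι → ℝ} {n : ℕ} {B : ℝ} (hB : 0 ≤ B)
    (hs : s.card ≤ 2 * n) (ha : ∀ i ∈ s, |a i| ≤ B) (hb : ∀ i ∈ s, |b i| ≤ B) :
    |∑ i ∈ s, (a i - b i)| ≤ 4 * n * B := by
  have h1 : ∀ i ∈ s, |a i - b i| ≤ 2 * B := fun i hi =>
    (abs_sub _ _).trans (by linarith [ha i hi, hb i hi])
  have h2 : (s.card : ℝ) ≤ 2 * n := by exact_mod_cast hs
  calc |∑ i ∈ s, (a i - b i)| ≤ ∑ i ∈ s, |a i - b i| := Finset.abs_sum_le_sum_abs _ _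
    _ ≤ s.card • (2 * B) := Finset.sum_le_card_nsmul _ _ _ h1
    _ = s.card * (2 * B) := nsmul_eq_mul _ _
    _ ≤ 2 * n * (2 * B) := by gcongr
    _ = 4 * n * B := by ring

/-! ### Vertices without arrivals and independence of their two sides -/

/-- The event that no car has arrived at `c`, as a function. -/
noncomputable def noCar (c : ℤ) (x : Config) : ℝ := if x.2 c = 0 then 1 else 0

theorem dependsOnVertices_noCar (c : ℤ) : DependsOnVertices {c} (noCar c) := fun x y h => by
  simp only [noCar, (h c (by simp)).2]

theorem abs_noCar_le (c : ℤ) (x : Config) : |noCar c x| ≤ 1 := by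
  unfold noCar; split_ifs <;> simp

theorem bddLocal_noCar (c : ℤ) : BddLocal (noCar c) :=
  ⟨(dependsOnVertices_noCar c).isLocal, 1, abs_noCar_le c⟩

theorem noCar_arrive_self (c : ℤ) (x : Config) : noCar c (arrive c x) = 0 := by
  simp [noCar, arrive_snd_self]

theorem noCar_arrive_of_ne {c k : ℤ} (h : k ≠ c) (x : Config) :
    noCar c (arrive k x) = noCar c x := by
  simp only [noCar, arrive_snd_of_ne h.symm]

theorem noCar_emptyConfig (c : ℤ) : noCar c emptyConfig = 1 := by simp [noCar, emptyConfig]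

/-- Functions bounded by one which depend on at most `2 * n` vertices of `s`. -/
def cylinder (s : Set ℤ) (n : ℕ) : Set (Config → ℝ) :=
  {f | (∀ x, |f x| ≤ 1) ∧ ∃ Λ : Finset ℤ, ↑Λ ⊆ s ∧ Λ.card ≤ 2 * n ∧ DependsOnVertices Λ f}

theorem cylinder_bddLocal {s : Set ℤ} {n : ℕ} {f : Config → ℝ} (hf : f ∈ cylinder s n) :
    BddLocal f := ⟨hf.2.imp fun _ h => h.2.2, 1, hf.1⟩

theorem cylinder_mono {s : Set ℤ} {n m : ℕ} (h : n ≤ m) : cylinder s n ⊆ cylinder s m :=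
  fun _ hf => ⟨hf.1, hf.2.imp fun _ hΛ => ⟨hΛ.1, hΛ.2.1.trans (by lia), hΛ.2.2⟩⟩

/-- The rank counts pairs of vertices, so one arrival raises it by one. The conditions on `k - 1`
and `k + 1` keep the function on its own side of a separating vertex. -/
theorem comp_arrive_mem_cylinder {s : Set ℤ} {n : ℕ} {f : Config → ℝ} (hf : ∀ x, |f x| ≤ 1)
    {Λ : Finset ℤ} (hs : ↑Λ ⊆ s) (hn : Λ.card ≤ 2 * n) (hΛ : DependsOnVertices Λ f) {k : ℤ}
    (hk : k ∈ Λ) (h1 : k - 1 ∈ s) (h2 : k + 1 ∈ s) :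
    (fun x => f (arrive k x)) ∈ cylinder s (n + 1) := by
  refine ⟨fun x => hf _, _, ?_, ?_, hΛ.comp_arrive k⟩
  · simp only [Finset.coe_insert]
    exact insert_subset h1 (insert_subset h2 (insert_subset (hs hk) hs))
  · exact (card_insert_neighbours_le hk).trans (by lia)

namespace IsScreeningProcess

variable {Ω : Type*} {mΩ : MeasurableSpace Ω} {P : Measure Ω} [IsProbabilityMeasure P]
  {ℱ : Filtration ℝ≥0 mΩ} {X : ℝ≥0 → Ω → Config}

/-- The law of the process is invariant under the symmetries of the line. -/
theorem expect_relabel (hX : IsScreeningProcess P ℱ X) (φ : ℤ ≃ ℤ) (hφ : PreservesNeighbours φ)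
    {f : Config → ℝ} (hloc : IsLocal f) (hf : ∀ x, |f x| ≤ 1) {t : ℝ} (ht : 0 ≤ t) :
    expect P X (fun x => f (relabel φ x)) t = expect P X f t := by
  have hrel : ∀ {f}, BddLocal f → BddLocal (fun x => f (relabel φ x)) := by
    rintro f ⟨⟨Λ, hΛ⟩, C, hC⟩
    exact ⟨⟨_, DependsOnVertices.comp_relabel hΛ φ⟩, C, fun x => hC _⟩
  obtain ⟨Λ₀, hΛ₀⟩ := hloc
  suffices h : expect P X f t - expect P X (fun x => f (relabel φ x)) t = 0 by linarith
  refine eq_zero_of_deriv_le_rank (C := 2) (K := 4) (cylinder univ)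
    (fun f t => expect P X f t - expect P X (fun x => f (relabel φ x)) t) (by norm_num) ?_ ?_ ?_ ?_
    Λ₀.card f ⟨hf, Λ₀, subset_univ _, by lia, hΛ₀⟩ t ht
  · intro n f hf t
    refine (abs_sub _ _).trans ?_
    linarith [abs_expect_le (P := P) (X := X) hf.1 t,
      abs_expect_le (P := P) (X := X) (fun x => hf.1 (relabel φ x)) t]
  · intro n f hf
    have hb := cylinder_bddLocal hf
    exact (hX.continuous_expect hb).sub (hX.continuous_expect (hrel hb))
  · intro n f hf
    have hb := cylinder_bddLocal hf
    change expect P X f 0 - expect P X (fun x => f (relabel φ x)) 0 = 0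
    rw [hX.expect_zero hb, hX.expect_zero (hrel hb)]
    exact sub_self _
  · intro n f hf t ht
    have hb := cylinder_bddLocal hf
    obtain ⟨hf1, Λ, -, hcard, hΛ⟩ := hf
    refine ⟨_, ((hX.hasDerivWithinAt_expect hb ht).sub
      (hX.hasDerivWithinAt_expect (hrel hb) ht)).mono (Ici_subset_Ici.2 ht), fun B hB => ?_⟩
    -- By `arrive_relabel` the derivative of the defect of `f` is the sum over `k ∈ Λ` of the defect
    -- of `f ∘ arrive k` minus that of `f`. With at most `2 * n` terms, each at most `2 * B`, this
    -- gives `K = 4`.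
    rw [hX.expect_generatorSc hΛ hb, hX.expect_generatorSc (hΛ.comp_relabel φ) (hrel hb),
      Finset.sum_map, ← Finset.sum_sub_distrib]
    have hmem : f ∈ cylinder univ (n + 1) := ⟨hf1, Λ, subset_univ _, by lia, hΛ⟩
    have hB0 : 0 ≤ B := (abs_nonneg _).trans (hB _ hmem)
    have h := abs_sum_sub_le (n := n) Λ hB0 hcard
      (a := fun k => expect P X (fun x => f (arrive k x)) t -
        expect P X (fun x => f (arrive k (relabel φ x))) t)
      (b := fun _ => expect P X f t - expect P X (fun x => f (relabel φ x)) t)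
      (fun k hk => hB _
        (comp_arrive_mem_cylinder hf1 (subset_univ _) hcard hΛ hk (mem_univ _) (mem_univ _)))
      (fun k hk => hB _ hmem)
    simp only [arrive_relabel φ hφ] at h
    refine (le_of_eq ?_).trans (h.trans ?_)
    · congr 1
      exact Finset.sum_congr rfl fun k _ => by simp only [Equiv.coe_toEmbedding]; ring
    · nlinarith

/-- The evolution on the event that no car has arrived at `c`. -/
theorem hasDerivWithinAt_expect_mul_noCar (hX : IsScreeningProcess P ℱ X) (c : ℤ) {Λ : Finset ℤ}
    {f : Config → ℝ} (hf : BddLocal f) (hΛ : DependsOnVertices Λ f) {t : ℝ} (ht : 0 ≤ t) :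
    HasDerivWithinAt (expect P X fun x => f x * noCar c x)
      (∑ k ∈ Λ.erase c, (expect P X (fun x => f (arrive k x) * noCar c x) t -
        expect P X (fun x => f x * noCar c x) t) - expect P X (fun x => f x * noCar c x) t)
      (Ici 0) t := by
  have hb := hf.mul (bddLocal_noCar c)
  have hΛ' : DependsOnVertices (insert c Λ) fun x => f x * noCar c x :=
    (hΛ.mono (Finset.subset_insert _ _)).mul ((dependsOnVertices_noCar c).mono (by simp))
  convert hX.hasDerivWithinAt_expect hb ht using 1
  rw [hX.expect_generatorSc hΛ' hb, ← Finset.add_sum_erase _ _ (Finset.mem_insert_self c Λ),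
    Finset.erase_insert_eq_erase, add_comm]
  -- An arrival at `c` ends the event, so its term is a pure loss at rate one.
  have h0 : expect P X (fun x => f (arrive c x) * noCar c (arrive c x)) t = 0 := by
    simp [noCar_arrive_self, expect]
  rw [h0, zero_sub, sub_eq_add_neg]
  congr 1
  refine Finset.sum_congr rfl fun k hk => ?_
  simp only [noCar_arrive_of_ne (Finset.ne_of_mem_erase hk)]

theorem expect_noCar (hX : IsScreeningProcess P ℱ X) (c : ℤ) {t : ℝ} (ht : 0 ≤ t) :
    expect P X (noCar c) t = Real.exp (-t) := by
  have hb : BddLocal (fun _ => 1) := ⟨⟨∅, fun _ _ _ => rfl⟩, 1, fun _ => by simp⟩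
  have h := eq_mul_exp_of_hasDerivWithinAt (u := expect P X (noCar c)) (a := 1)
    (fun t ht => by
      simpa using hX.hasDerivWithinAt_expect_mul_noCar c hb (Λ := ∅) (fun _ _ _ => rfl) ht) ht
  rw [h, hX.expect_zero (bddLocal_noCar c), noCar_emptyConfig]
  simp

/-- Given that no car has arrived at `c`, the two sides of `c` are independent. -/
theorem expect_mul_mul_noCar (hX : IsScreeningProcess P ℱ X) (c : ℤ) {g h : Config → ℝ}
    {Λ₁ Λ₂ : Finset ℤ} (hg : ∀ x, |g x| ≤ 1) (hh : ∀ x, |h x| ≤ 1)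
    (hΛ₁ : DependsOnVertices Λ₁ g) (hΛ₂ : DependsOnVertices Λ₂ h)
    (hc₁ : ∀ k ∈ Λ₁, k ≤ c) (hc₂ : ∀ k ∈ Λ₂, c ≤ k) {t : ℝ} (ht : 0 ≤ t) :
    expect P X (fun x => g x * h x * noCar c x) t * Real.exp (-t) =
      expect P X (fun x => g x * noCar c x) t * expect P X (fun x => h x * noCar c x) t := by
  -- With the probability of no arrival in place of the exponential, the defect is a difference of
  -- products of expectations, and the defects for all pairs `(g, h)` satisfy a closed linear
  -- system.
  rw [← hX.expect_noCar c ht, ← sub_eq_zero]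
  have hb1 : ∀ f : Config → ℝ, (∀ x, |f x| ≤ 1) → ∀ x, |f x * noCar c x| ≤ 1 := fun f hf x => by
    rw [abs_mul]
    exact mul_le_one₀ (hf x) (abs_nonneg _) (abs_noCar_le c x)
  have hb2 : ∀ f g : Config → ℝ, (∀ x, |f x| ≤ 1) → (∀ x, |g x| ≤ 1) →
      ∀ x, |f x * g x| ≤ 1 := fun f g hf hg x => by
    rw [abs_mul]
    exact mul_le_one₀ (hf x) (abs_nonneg _) (hg x)
  refine eq_zero_of_deriv_le_rank (C := 2) (K := 8)
    (fun n => cylinder (Iic c) n ×ˢ cylinder (Ici c) n)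
    (fun p t => expect P X (fun x => p.1 x * p.2 x * noCar c x) t * expect P X (noCar c) t -
      expect P X (fun x => p.1 x * noCar c x) t * expect P X (fun x => p.2 x * noCar c x) t)
    (by norm_num) ?_ ?_ ?_ ?_
    (Λ₁.card + Λ₂.card) (g, h) ⟨⟨hg, Λ₁, hc₁, by lia, hΛ₁⟩, ⟨hh, Λ₂, hc₂, by lia, hΛ₂⟩⟩ t ht
  · rintro n ⟨g, h⟩ ⟨hg, hh⟩ t
    have h1 := abs_expect_le (P := P) (X := X) (hb1 _ (hb2 g h hg.1 hh.1)) t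
    have h2 := abs_expect_le (P := P) (X := X) (abs_noCar_le c) t
    have h3 := abs_expect_le (P := P) (X := X) (hb1 g hg.1) t
    have h4 := abs_expect_le (P := P) (X := X) (hb1 h hh.1) t
    refine (abs_sub _ _).trans ?_
    rw [abs_mul, abs_mul]
    linarith [mul_le_one₀ h1 (abs_nonneg _) h2, mul_le_one₀ h3 (abs_nonneg _) h4]
  · rintro n ⟨g, h⟩ ⟨hg, hh⟩
    have hg' := cylinder_bddLocal hg
    have hh' := cylinder_bddLocal hh
    have hn := bddLocal_noCar c
    exact ((hX.continuous_expect ((hg'.mul hh').mul hn)).mul (hX.continuous_expect hn)).sub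
      ((hX.continuous_expect (hg'.mul hn)).mul (hX.continuous_expect (hh'.mul hn)))
  · rintro n ⟨g, h⟩ ⟨hg, hh⟩
    have hg' := cylinder_bddLocal hg
    have hh' := cylinder_bddLocal hh
    have hn := bddLocal_noCar c
    simp only [hX.expect_zero ((hg'.mul hh').mul hn), hX.expect_zero hn,
      hX.expect_zero (hg'.mul hn), hX.expect_zero (hh'.mul hn), noCar_emptyConfig]
    ring
  · rintro n ⟨g, h⟩ ⟨hg, hh⟩ t ht
    have hg' := cylinder_bddLocal hg
    have hh' := cylinder_bddLocal hh
    have hn := bddLocal_noCar c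
    obtain ⟨hg1, Λ₁, hc₁, hcard₁, hΛ₁⟩ := id hg
    obtain ⟨hh1, Λ₂, hc₂, hcard₂, hΛ₂⟩ := id hh
    have hN : HasDerivWithinAt (expect P X (noCar c)) (-expect P X (noCar c) t) (Ici 0) t := by
      have hb : BddLocal (fun _ => 1) := ⟨⟨∅, fun _ _ _ => rfl⟩, 1, fun _ => by simp⟩
      simpa using hX.hasDerivWithinAt_expect_mul_noCar c hb (Λ := ∅) (fun _ _ _ => rfl) ht
    have hG := hX.hasDerivWithinAt_expect_mul_noCar c hg' hΛ₁ ht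
    have hH := hX.hasDerivWithinAt_expect_mul_noCar c hh' hΛ₂ ht
    have hGH := hX.hasDerivWithinAt_expect_mul_noCar c (hg'.mul hh') (Λ := Λ₁ ∪ Λ₂)
      ((hΛ₁.mono Finset.subset_union_left).mul (hΛ₂.mono Finset.subset_union_right)) ht
    have hne₁ : ∀ k ∈ Λ₁.erase c, k < c := fun k hk =>
      lt_of_le_of_ne (hc₁ (Finset.mem_of_mem_erase hk)) (Finset.ne_of_mem_erase hk)
    have hne₂ : ∀ k ∈ Λ₂.erase c, c < k := fun k hk =>
      lt_of_le_of_ne (hc₂ (Finset.mem_of_mem_erase hk)) (Finset.ne_of_mem_erase hk).symm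
    have hdisj : Disjoint (Λ₁.erase c) (Λ₂.erase c) :=
      Finset.disjoint_left.2 fun k h1 h2 => lt_asymm (hne₁ k h1) (hne₂ k h2)
    -- An arrival strictly to one side of `c` alters only the function on that side, so the sum over
    -- arrivals splits.
    have hh_arr : ∀ k ∈ Λ₁.erase c, ∀ x, h (arrive k x) = h x := fun k hk x =>
      hΛ₂.arrive_eq (fun hk' => (hne₁ k hk).not_ge (hc₂ hk')) x
    have hg_arr : ∀ k ∈ Λ₂.erase c, ∀ x, g (arrive k x) = g x := fun k hk x =>
      hΛ₁.arrive_eq (fun hk' => (hne₂ k hk).not_ge (hc₁ hk')) x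
    rw [Finset.erase_union_distrib, Finset.sum_union hdisj,
      Finset.sum_congr rfl (fun k hk => by simp only [hh_arr k hk]; rfl),
      Finset.sum_congr (s₁ := Λ₂.erase c) rfl (fun k hk => by simp only [hg_arr k hk]; rfl)] at hGH
    refine ⟨_, ((hGH.mul hN).sub (hG.mul hH)).mono (Ici_subset_Ici.2 ht), fun B hB => ?_⟩
    have hmg : g ∈ cylinder (Iic c) (n + 1) := cylinder_mono n.le_succ hg
    have hmh : h ∈ cylinder (Ici c) (n + 1) := cylinder_mono n.le_succ hh
    have hB1 := hB (g, h) ⟨hmg, hmh⟩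
    have hB0 : 0 ≤ B := (abs_nonneg _).trans hB1
    have hs1 := abs_sum_sub_le (n := n) (Λ₁.erase c) hB0 (Finset.card_erase_le.trans hcard₁)
      (fun k hk => hB ((fun x => g (arrive k x)), h) ⟨comp_arrive_mem_cylinder hg1 hc₁ hcard₁ hΛ₁
        (Finset.mem_of_mem_erase hk) (by have := hne₁ k hk; simp only [mem_Iic]; lia)
        (by have := hne₁ k hk; simp only [mem_Iic]; lia), hmh⟩) (fun k _ => hB1)
    have hs2 := abs_sum_sub_le (n := n) (Λ₂.erase c) hB0 (Finset.card_erase_le.trans hcard₂)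
      (fun k hk => hB (g, (fun x => h (arrive k x))) ⟨hmg, comp_arrive_mem_cylinder hh1 hc₂ hcard₂
        hΛ₂ (Finset.mem_of_mem_erase hk) (by have := hne₂ k hk; simp only [mem_Ici]; lia)
        (by have := hne₂ k hk; simp only [mem_Ici]; lia)⟩) (fun k _ => hB1)
    simp only at hs1 hs2 hB1
    -- The derivative of the defect is one sum of differences of defects for each side, minus twice
    -- the defect itself: each factor of the products decays at rate one. The total `4 * n + 4 * n +
    -- 2` is at most `8 * (n + 1)`.
    have hbound : ∀ a b c d : ℝ, |a| ≤ 4 * n * B → |b| ≤ 4 * n * B → |c| ≤ B → d = a + b - 2 * c →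
        |d| ≤ 8 * (n + 1) * B := by
      rintro a b c d ha hb hc rfl
      rw [abs_le] at *
      constructor <;> nlinarith
    refine hbound _ _ _ _ hs1 hs2 hB1 ?_
    have e1 : ∀ (s : Finset ℤ) (a b : ℤ → ℝ) (y z p q : ℝ),
        ∑ k ∈ s, (a k * p - b k * q - (y * p - z * q)) =
          (∑ k ∈ s, (a k - y)) * p - (∑ k ∈ s, (b k - z)) * q := fun s a b y z p q => by
      rw [Finset.sum_mul, Finset.sum_mul, ← Finset.sum_sub_distrib]
      exact Finset.sum_congr rfl fun k _ => by ring
    have e2 : ∀ (s : Finset ℤ) (a b : ℤ → ℝ) (y z p q : ℝ),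
        ∑ k ∈ s, (a k * p - q * b k - (y * p - q * z)) =
          (∑ k ∈ s, (a k - y)) * p - q * (∑ k ∈ s, (b k - z)) := fun s a b y z p q => by
      rw [Finset.sum_mul, Finset.mul_sum, ← Finset.sum_sub_distrib]
      exact Finset.sum_congr rfl fun k _ => by ring
    rw [e1, e2]
    ring

end IsScreeningProcess

/-! ### Regular configurations -/

/-- The event that the vertex `k` is in state `s`, as a function. -/
noncomputable def spinAt (k : ℤ) (s : Spin) (x : Config) : ℝ := if x.1 k = s then 1 else 0

theorem dependsOnVertices_spinAt {Λ : Finset ℤ} {k : ℤ} (hk : k ∈ Λ) (s : Spin) :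
    DependsOnVertices Λ (spinAt k s) := fun x y h => by
  simp only [spinAt, (h k hk).1]

theorem abs_spinAt_le (k : ℤ) (s : Spin) (x : Config) : |spinAt k s x| ≤ 1 := by
  unfold spinAt; split_ifs <;> simp

theorem bddLocal_spinAt (k : ℤ) (s : Spin) : BddLocal (spinAt k s) :=
  ⟨(dependsOnVertices_spinAt (Finset.mem_singleton_self k) s).isLocal, 1, abs_spinAt_le k s⟩

theorem spinAt_relabel (φ : ℤ → ℤ) (k : ℤ) (s : Spin) (x : Config) :
    spinAt k s (relabel φ x) = spinAt (φ k) s x := rfl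

theorem noCar_relabel (φ : ℤ → ℤ) (k : ℤ) (x : Config) :
    noCar k (relabel φ x) = noCar (φ k) x := rfl

theorem abs_mul_le_one {a b : ℝ} (ha : |a| ≤ 1) (hb : |b| ≤ 1) : |a * b| ≤ 1 := by
  rw [abs_mul]
  exact mul_le_one₀ ha (abs_nonneg _) hb

/-- A vertex without arrivals is vacant, and a vacant vertex with arrivals is blocked by a
neighbour in the second line. -/
def Regular (x : Config) : Prop :=
  ∀ k, (x.2 k = 0 → x.1 k = 0) ∧
    (x.1 k = 0 → (x.1 (k - 1) = 0 ∨ x.1 (k - 1) = 1) → (x.1 (k + 1) = 0 ∨ x.1 (k + 1) = 1) →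
      x.2 k = 0)

/-- Cars in the second line never leave, so a second line that is free after an arrival was free
before it. -/
theorem eq_zero_or_one_of_nextSpin {a b d : Spin} (h : nextSpin a b d = 0 ∨ nextSpin a b d = 1) :
    b = 0 ∨ b = 1 := by
  revert a b d; unfold nextSpin; decide

theorem nextSpin_ne_zero {a b d : Spin} (ha : a = 0 ∨ a = 1) (hd : d = 0 ∨ d = 1) :
    nextSpin a b d ≠ 0 := by
  revert a b d; unfold nextSpin; decide

theorem fst_eq_zero_or_one_of_arrive {j k : ℤ} {x : Config}
    (h : (arrive j x).1 k = 0 ∨ (arrive j x).1 k = 1) : x.1 k = 0 ∨ x.1 k = 1 := by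
  by_cases hk : k = j
  · subst hk
    rw [arrive_fst_self] at h
    exact eq_zero_or_one_of_nextSpin h
  · rwa [arrive_fst_of_ne hk] at h

namespace IsScreeningProcess

variable {Ω : Type*} {mΩ : MeasurableSpace Ω} {P : Measure Ω} [IsProbabilityMeasure P]
  {ℱ : Filtration ℝ≥0 mΩ} {X : ℝ≥0 → Ω → Config}

/-- The indicator of a local property that no arrival can create has nonpositive generator; starting
from zero, its expectation stays zero. -/
theorem ae_not_of_arrive (hX : IsScreeningProcess P ℱ X) {p : Config → Prop} {Λ : Finset ℤ}
    (hΛ : ∀ x y : Config, (∀ k ∈ Λ, x.1 k = y.1 k ∧ x.2 k = y.2 k) → (p x ↔ p y))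
    (harr : ∀ k x, p (arrive k x) → p x) (h0 : ¬ p emptyConfig) (t : ℝ≥0) :
    ∀ᵐ ω ∂P, ¬ p (X t ω) := by
  classical
  have h := hX.ae_eq_zero_of_arrive_le (f := fun x => if p x then 1 else 0)
    ⟨⟨Λ, fun x y h => by simp only [hΛ x y h]⟩, 1,
      fun x => by dsimp only; split_ifs <;> simp⟩
    (fun x => by split_ifs <;> simp)
    (fun k x => by
      by_cases h : p (arrive k x)
      · rw [if_pos h, if_pos (harr k x h)]
      · rw [if_neg h]
        split_ifs <;> simp)
    (if_neg h0) t
  exact h.mono fun ω hω => by simpa using hω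

theorem ae_regular (hX : IsScreeningProcess P ℱ X) (t : ℝ≥0) : ∀ᵐ ω ∂P, Regular (X t ω) := by
  refine ae_all_iff.2 fun k => ?_
  have h1 := hX.ae_not_of_arrive (p := fun x => x.2 k = 0 ∧ x.1 k ≠ 0) (Λ := {k})
    (fun x y h => by rw [(h k (by simp)).1, (h k (by simp)).2])
    (fun j x h => by
      by_cases hj : k = j
      · subst hj
        rw [arrive_snd_self] at h
        exact absurd h.1 (Nat.succ_ne_zero _)
      · rwa [arrive_snd_of_ne hj, arrive_fst_of_ne hj] at h)
    (by simp [emptyConfig]) t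
  have h2 := hX.ae_not_of_arrive
    (p := fun x => x.1 k = 0 ∧ (x.1 (k - 1) = 0 ∨ x.1 (k - 1) = 1) ∧
      (x.1 (k + 1) = 0 ∨ x.1 (k + 1) = 1) ∧ x.2 k ≠ 0) (Λ := {k - 1, k, k + 1})
    (fun x y h => by
      rw [(h (k - 1) (by simp)).1, (h k (by simp)).1, (h (k + 1) (by simp)).1,
        (h k (by simp)).2])
    (fun j x h => by
      have ha := fst_eq_zero_or_one_of_arrive h.2.1
      have hd := fst_eq_zero_or_one_of_arrive h.2.2.1
      by_cases hj : k = j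
      · subst hj
        rw [arrive_fst_self] at h
        exact absurd h.1 (nextSpin_ne_zero ha hd)
      · rw [arrive_fst_of_ne hj, arrive_snd_of_ne hj] at h
        exact ⟨h.1, ha, hd, h.2.2.2⟩)
    (by simp [emptyConfig]) t
  filter_upwards [h1, h2] with ω h1 h2
  tauto

/-- Identities between expectations need checking on regular configurations only. There the vacancy
of an unblocked vertex may be replaced by the absence of arrivals, which makes independence
applicable. -/
theorem expect_congr (hX : IsScreeningProcess P ℱ X) {f g : Config → ℝ}
    (h : ∀ x, Regular x → f x = g x) (t : ℝ) : expect P X f t = expect P X g t :=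
  integral_congr_ae ((hX.ae_regular _).mono fun _ hω => h _ hω)

theorem expect_add (hX : IsScreeningProcess P ℱ X) {f g : Config → ℝ} (hf : BddLocal f)
    (hg : BddLocal g) (t : ℝ) :
    expect P X (fun x => f x + g x) t = expect P X f t + expect P X g t :=
  integral_add (hX.integrable hf _) (hX.integrable hg _)

theorem expect_reflect (hX : IsScreeningProcess P ℱ X) (c : ℤ) {f : Config → ℝ}
    (hloc : IsLocal f) (hf : ∀ x, |f x| ≤ 1) {t : ℝ} (ht : 0 ≤ t) :
    expect P X (fun x => f (relabel (fun k => c - k) x)) t = expect P X f t :=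
  hX.expect_relabel (Equiv.subLeft c)
    (fun k => Or.inr ⟨by simp [Equiv.subLeft]; ring, by simp [Equiv.subLeft]; ring⟩) hloc hf ht

theorem expect_shift (hX : IsScreeningProcess P ℱ X) (c : ℤ) {f : Config → ℝ}
    (hloc : IsLocal f) (hf : ∀ x, |f x| ≤ 1) {t : ℝ} (ht : 0 ≤ t) :
    expect P X (fun x => f (relabel (fun k => k + c) x)) t = expect P X f t :=
  hX.expect_relabel (Equiv.addRight c)
    (fun k => Or.inl ⟨by simp; ring, by simp; ring⟩) hloc hf ht

/-- Vertices without arrivals. -/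
theorem expect_noCar_mul_noCar (hX : IsScreeningProcess P ℱ X) {j k : ℤ} (hjk : j ≠ k) {t : ℝ}
    (ht : 0 ≤ t) : expect P X (fun x => noCar j x * noCar k x) t = Real.exp (-(2 * t)) := by
  have h := eq_mul_exp_of_hasDerivWithinAt (u := expect P X fun x => noCar j x * noCar k x) (a := 2)
    (fun t ht => by
      have h := hX.hasDerivWithinAt_expect_mul_noCar k (bddLocal_noCar j)
        (dependsOnVertices_noCar j) ht
      rw [Finset.erase_eq_of_notMem (by simpa using hjk.symm), Finset.sum_singleton] at h
      convert h using 1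
      have h0 : expect P X (fun x => noCar j (arrive j x) * noCar k x) t = 0 := by
        simp [noCar_arrive_self, expect]
      rw [h0]
      ring) ht
  rw [h, hX.expect_zero ((bddLocal_noCar j).mul (bddLocal_noCar k)), noCar_emptyConfig,
    noCar_emptyConfig]
  simp

/-- The expectation over the right side of a vertex without arrivals. -/
theorem expect_noCar_right (hX : IsScreeningProcess P ℱ X) (c : ℤ) (s : Spin) {t : ℝ}
    (ht : 0 ≤ t) : expect P X (fun x => spinAt (c + 1) s x * noCar c x) t =
      expect P X (fun x => spinAt 1 s x * noCar 0 x) t := by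
  have h := hX.expect_shift c (f := fun x => spinAt 1 s x * noCar 0 x)
    ((bddLocal_spinAt 1 s).mul (bddLocal_noCar 0)).1
    (fun x => abs_mul_le_one (abs_spinAt_le _ _ _) (abs_noCar_le _ _)) ht
  rw [← h]
  simp only [spinAt_relabel, noCar_relabel, zero_add, add_comm c]

theorem expect_noCar_left (hX : IsScreeningProcess P ℱ X) (c : ℤ) (s : Spin) {t : ℝ}
    (ht : 0 ≤ t) : expect P X (fun x => spinAt (c - 1) s x * noCar c x) t =
      expect P X (fun x => spinAt 1 s x * noCar 0 x) t := by
  have h := hX.expect_reflect c (f := fun x => spinAt 1 s x * noCar 0 x)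
    ((bddLocal_spinAt 1 s).mul (bddLocal_noCar 0)).1
    (fun x => abs_mul_le_one (abs_spinAt_le _ _ _) (abs_noCar_le _ _)) ht
  rw [← h]
  simp only [spinAt_relabel, noCar_relabel, sub_zero]

end IsScreeningProcess

/-! ### Pattern probabilities in terms of one-sided densities -/

theorem exp_neg_two_mul (t : ℝ) : Real.exp (-(2 * t)) = Real.exp (-t) ^ 2 := by
  rw [← Real.exp_nat_mul]; congr 1; push_cast; ring

theorem exp_neg_three_mul (t : ℝ) : Real.exp (-(3 * t)) = Real.exp (-t) ^ 3 := by
  rw [← Real.exp_nat_mul]; congr 1; push_cast; ring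

namespace IsScreeningProcess

variable {Ω : Type*} {mΩ : MeasurableSpace Ω} {P : Measure Ω}
  {ℱ : Filtration ℝ≥0 mΩ} {X : ℝ≥0 → Ω → Config}

theorem real_setOf_eq_expect (hX : IsScreeningProcess P ℱ X) {g : Config → ℝ} (hg : IsLocal g)
    {p : Config → Prop} (h1 : ∀ x, p x → g x = 1) (h0 : ∀ x, ¬ p x → g x = 0) (t : ℝ) :
    P.real {ω | p (X t.toNNReal ω)} = expect P X g t := by
  have hset : {ω | p (X t.toNNReal ω)} = (fun ω => g (X t.toNNReal ω)) ⁻¹' {1} := by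
    ext ω
    by_cases h : p (X t.toNNReal ω)
    · simp [h, h1 _ h]
    · simp [h, h0 _ h]
  have hm : MeasurableSet {ω | p (X t.toNNReal ω)} := by
    rw [hset]
    exact hX.measurable_comp hg _ (measurableSet_singleton 1)
  rw [← integral_indicator_one hm, expect]
  congr 1
  ext ω
  by_cases h : p (X t.toNNReal ω)
  · rw [h1 _ h, indicator_of_mem (by exact h), Pi.one_apply]
  · rw [h0 _ h, indicator_of_notMem (by exact h)]

theorem measurableSet_noArrival (hX : IsScreeningProcess P ℱ X) (t : ℝ) :
    MeasurableSet (noArrival X t) :=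
  ((measurable_pi_apply (0 : ℤ)).comp (measurable_snd.comp (hX.measurable _)))
    (measurableSet_singleton 0)

theorem D_eq_expect (hX : IsScreeningProcess P ℱ X) (s : Spin) (t : ℝ) :
    D P X s t = expect P X (spinAt 0 s) t :=
  hX.real_setOf_eq_expect (p := fun x => x.1 0 = s) (bddLocal_spinAt 0 s).1 (by simp [spinAt])
    (by simp [spinAt]) t

theorem D₃_eq_expect (hX : IsScreeningProcess P ℱ X) (a b d : Spin) (t : ℝ) :
    D₃ P X a b d t = expect P X (fun x => spinAt (-1) a x * spinAt 0 b x * spinAt 1 d x) t :=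
  hX.real_setOf_eq_expect (p := fun x => x.1 (-1) = a ∧ x.1 0 = b ∧ x.1 1 = d)
    (((bddLocal_spinAt (-1) a).mul (bddLocal_spinAt 0 b)).mul (bddLocal_spinAt 1 d)).1
    (by simp +contextual [spinAt]) (by simp only [spinAt]; grind) t

variable [IsProbabilityMeasure P]

theorem real_noArrival (hX : IsScreeningProcess P ℱ X) {t : ℝ} (ht : 0 ≤ t) :
    P.real (noArrival X t) = Real.exp (-t) := by
  rw [← hX.expect_noCar 0 ht]
  exact hX.real_setOf_eq_expect (p := fun x => x.2 0 = 0) (bddLocal_noCar 0).1 (by simp [noCar])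
    (by simp [noCar]) t

theorem exp_mul_cond (hX : IsScreeningProcess P ℱ X) {p : Config → Prop} {g : Config → ℝ}
    (hg : IsLocal fun x => g x * noCar 0 x)
    (h1 : ∀ x, p x → g x = 1) (h0 : ∀ x, ¬ p x → g x = 0) {t : ℝ} (ht : 0 ≤ t) :
    Real.exp (-t) * (P[|noArrival X t]).real {ω | p (X t.toNNReal ω)} =
      expect P X (fun x => g x * noCar 0 x) t := by
  rw [← hX.real_noArrival ht, Measure.real, Measure.real,
    cond_apply (hX.measurableSet_noArrival t), ENNReal.toReal_mul, ENNReal.toReal_inv,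
    ← Measure.real, ← Measure.real, mul_inv_cancel_left₀]
  · exact hX.real_setOf_eq_expect (p := fun x => x.2 0 = 0 ∧ p x) hg
      (fun x h => by rw [h1 x h.2, noCar, if_pos h.1, mul_one])
      (fun x h => by
        by_cases hp : p x
        · rw [noCar, if_neg fun h' => h ⟨h', hp⟩, mul_zero]
        · rw [h0 x hp, zero_mul]) t
  · rw [hX.real_noArrival ht]
    exact (Real.exp_pos _).ne'

theorem expect_eq_exp_mul_f (hX : IsScreeningProcess P ℱ X) (s : Spin) {t : ℝ} (ht : 0 ≤ t) :
    expect P X (fun x => spinAt 1 s x * noCar 0 x) t = Real.exp (-t) * f P X s t :=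
  (hX.exp_mul_cond (p := fun x => x.1 1 = s)
    ((bddLocal_spinAt 1 s).mul (bddLocal_noCar 0)).1 (by simp [spinAt]) (by simp [spinAt]) ht).symm

theorem expect_eq_exp_mul_R (hX : IsScreeningProcess P ℱ X) {t : ℝ} (ht : 0 ≤ t) :
    expect P X (fun x => spinAt 1 1 x * spinAt 2 0 x * noCar 0 x) t =
      Real.exp (-t) * R P X t :=
  (hX.exp_mul_cond (p := fun x => x.1 1 = 1 ∧ x.1 2 = 0) (g := fun x => spinAt 1 1 x * spinAt 2 0 x)
    (((bddLocal_spinAt 1 1).mul (bddLocal_spinAt 2 0)).mul (bddLocal_noCar 0)).1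
    (by simp +contextual [spinAt]) (by simp only [spinAt]; grind) ht).symm

/-- Both neighbours of a vertex without arrivals. -/
theorem expect_both_sides (hX : IsScreeningProcess P ℱ X) (a b : Spin) {t : ℝ} (ht : 0 ≤ t) :
    expect P X (fun x => spinAt (-1) a x * spinAt 1 b x * noCar 0 x) t =
      f P X a t * f P X b t * Real.exp (-t) := by
  have h := hX.expect_mul_mul_noCar 0 (abs_spinAt_le (-1) a) (abs_spinAt_le 1 b)
    (dependsOnVertices_spinAt (Finset.mem_singleton_self _) _)
    (dependsOnVertices_spinAt (Finset.mem_singleton_self _) _) (by simp) (by simp) ht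
  have hl := hX.expect_noCar_left 0 a ht
  rw [zero_sub] at hl
  rw [hl, hX.expect_eq_exp_mul_f a ht, hX.expect_eq_exp_mul_f b ht] at h
  refine mul_right_cancel₀ (Real.exp_pos (-t)).ne' (h.trans ?_)
  ring

/-- The right neighbour of two adjacent vertices without arrivals. -/
theorem expect_two_noCar_right (hX : IsScreeningProcess P ℱ X) (b : Spin) {t : ℝ} (ht : 0 ≤ t) :
    expect P X (fun x => noCar 0 x * spinAt 2 b x * noCar 1 x) t =
      Real.exp (-t) ^ 2 * f P X b t := by
  have h := hX.expect_mul_mul_noCar 1 (abs_noCar_le 0) (abs_spinAt_le 2 b)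
    (dependsOnVertices_noCar 0)
    (dependsOnVertices_spinAt (Finset.mem_singleton_self _) _) (by simp) (by simp) ht
  have hr := hX.expect_noCar_right 1 b ht
  rw [one_add_one_eq_two] at hr
  rw [hr, hX.expect_eq_exp_mul_f b ht, hX.expect_noCar_mul_noCar (by simp) ht,
    exp_neg_two_mul] at h
  refine mul_right_cancel₀ (Real.exp_pos (-t)).ne' (h.trans ?_)
  ring

theorem expect_three_noCar (hX : IsScreeningProcess P ℱ X) {t : ℝ} (ht : 0 ≤ t) :
    expect P X (fun x => noCar 0 x * noCar 2 x * noCar 1 x) t = Real.exp (-t) ^ 3 := by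
  have h := hX.expect_mul_mul_noCar 1 (abs_noCar_le 0) (abs_noCar_le 2)
    (dependsOnVertices_noCar 0) (dependsOnVertices_noCar 2) (by simp) (by simp) ht
  rw [hX.expect_noCar_mul_noCar (by simp) ht, hX.expect_noCar_mul_noCar (by simp) ht,
    exp_neg_two_mul] at h
  refine mul_right_cancel₀ (Real.exp_pos (-t)).ne' (h.trans ?_)
  ring

/-- A car in the first line between two vertices without arrivals. -/
theorem expect_noCar_one_noCar (hX : IsScreeningProcess P ℱ X) {t : ℝ} (ht : 0 ≤ t) :
    expect P X (fun x => spinAt 1 1 x * noCar 2 x * noCar 0 x) t = t * Real.exp (-t) ^ 3 := by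
  have hb := (bddLocal_spinAt 1 1).mul (bddLocal_noCar 2)
  have hΛ : DependsOnVertices {1, 2} fun x => spinAt 1 1 x * noCar 2 x :=
    (dependsOnVertices_spinAt (by simp) 1).mul ((dependsOnVertices_noCar 2).mono (by simp))
  -- The event means exactly one arrival at `1` and none at `0` and `2`, with probability `t * exp
  -- (-t) * exp (-2 * t)`. The difference from this value decays at rate `3` and starts at zero.
  have hu : ∀ t, 0 ≤ t → HasDerivWithinAt
      (fun t => expect P X (fun x => spinAt 1 1 x * noCar 2 x * noCar 0 x) t -
        t * Real.exp (-(3 * t)))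
      (-(3 * (expect P X (fun x => spinAt 1 1 x * noCar 2 x * noCar 0 x) t -
        t * Real.exp (-(3 * t))))) (Ici 0) t := fun t ht => by
    have h := hX.hasDerivWithinAt_expect_mul_noCar 0 hb hΛ ht
    rw [Finset.erase_eq_of_notMem (by simp), Finset.sum_pair (by simp)] at h
    -- Between two vacant vertices an arrival produces state `1` only if the vertex was vacant,
    -- which for a regular configuration means that no car had arrived there.
    have h1 : expect P X (fun x => spinAt 1 1 (arrive 1 x) * noCar 2 (arrive 1 x) * noCar 0 x) t =
        Real.exp (-t) ^ 3 := by
      rw [← hX.expect_three_noCar ht]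
      refine hX.expect_congr (fun x hx => ?_) t
      rw [noCar_arrive_of_ne (by simp)]
      simp only [spinAt, noCar, arrive_fst_self, nextSpin]
      have h0 := hx 0
      have h1 := hx 1
      have h2 := hx 2
      norm_num at h0 h1 h2 ⊢
      grind
    have h2 : expect P X (fun x => spinAt 1 1 (arrive 2 x) * noCar 2 (arrive 2 x) * noCar 0 x) t =
        0 := by simp [noCar_arrive_self, expect]
    rw [h1, h2] at h
    have he : HasDerivWithinAt (fun t => Real.exp (-(3 * t))) (Real.exp (-(3 * t)) * (-(3 * 1)))
        (Ici 0) t := ((hasDerivAt_id t).const_mul 3).neg.exp.hasDerivWithinAt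
    exact (h.sub ((hasDerivWithinAt_id t _).mul he)).congr_deriv
      (by rw [exp_neg_three_mul]; simp only [id]; ring)
  have h := eq_mul_exp_of_hasDerivWithinAt hu ht
  have he : spinAt 1 1 emptyConfig = 0 := by simp [spinAt, emptyConfig]
  rw [hX.expect_zero (hb.mul (bddLocal_noCar 0)), exp_neg_three_mul, he] at h
  linarith

/-- The vertex `2` has no arrivals and separates the vertices `0` and `1` from `3`. -/
theorem expect_noCar_one_noCar_right (hX : IsScreeningProcess P ℱ X) (b : Spin) {t : ℝ}
    (ht : 0 ≤ t) :
    expect P X (fun x => spinAt 1 1 x * noCar 0 x * spinAt 3 b x * noCar 2 x) t =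
      t * Real.exp (-t) ^ 3 * f P X b t := by
  have h := hX.expect_mul_mul_noCar 2 (g := fun x => spinAt 1 1 x * noCar 0 x) (Λ₁ := {1, 0})
    (fun x => abs_mul_le_one (abs_spinAt_le 1 1 x) (abs_noCar_le 0 x)) (abs_spinAt_le 3 b)
    ((dependsOnVertices_spinAt (by simp) 1).mul ((dependsOnVertices_noCar 0).mono (by simp)))
    (dependsOnVertices_spinAt (Finset.mem_singleton_self _) _) (by simp) (by simp) ht
  have hr := hX.expect_noCar_right 2 b ht
  rw [two_add_one_eq_three] at hr
  have hl := hX.expect_noCar_one_noCar ht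
  simp only [mul_right_comm _ (noCar 2 _) (noCar 0 _)] at hl
  rw [hr, hl, hX.expect_eq_exp_mul_f b ht] at h
  refine mul_right_cancel₀ (Real.exp_pos (-t)).ne' (h.trans ?_)
  ring

/-- The vertex `1` separates; the reflection `k ↦ 1 - k` turns the pattern on its left into the one
defining `R`. -/
theorem expect_one_zero_right (hX : IsScreeningProcess P ℱ X) (b : Spin) {t : ℝ} (ht : 0 ≤ t) :
    expect P X (fun x => spinAt 0 1 x * spinAt (-1) 0 x * spinAt 2 b x * noCar 1 x) t =
      R P X t * f P X b t * Real.exp (-t) := by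
  have h := hX.expect_mul_mul_noCar 1 (g := fun x => spinAt 0 1 x * spinAt (-1) 0 x)
    (Λ₁ := {0, -1}) (fun x => abs_mul_le_one (abs_spinAt_le 0 1 x) (abs_spinAt_le (-1) 0 x))
    (abs_spinAt_le 2 b)
    ((dependsOnVertices_spinAt (by simp) 1).mul (dependsOnVertices_spinAt (by simp) 0))
    (dependsOnVertices_spinAt (Finset.mem_singleton_self _) _) (by simp) (by simp) ht
  have hr := hX.expect_noCar_right 1 b ht
  rw [one_add_one_eq_two] at hr
  have hl := hX.expect_reflect 1 (f := fun x => spinAt 1 1 x * spinAt 2 0 x * noCar 0 x)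
    (((bddLocal_spinAt 1 1).mul (bddLocal_spinAt 2 0)).mul (bddLocal_noCar 0)).1
    (fun x => abs_mul_le_one (abs_mul_le_one (abs_spinAt_le _ _ _) (abs_spinAt_le _ _ _))
      (abs_noCar_le _ _)) ht
  simp only [spinAt_relabel, noCar_relabel, sub_self, sub_zero,
    show (1 : ℤ) - 2 = -1 from rfl] at hl
  rw [hr, hl, hX.expect_eq_exp_mul_f b ht, hX.expect_eq_exp_mul_R ht] at h
  refine mul_right_cancel₀ (Real.exp_pos (-t)).ne' (h.trans ?_)
  ring

theorem expect_one_zero_left (hX : IsScreeningProcess P ℱ X) (b : Spin) {t : ℝ} (ht : 0 ≤ t) :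
    expect P X (fun x => spinAt 0 1 x * spinAt 1 0 x * spinAt (-2) b x * noCar (-1) x) t =
      R P X t * f P X b t * Real.exp (-t) := by
  rw [← hX.expect_one_zero_right b ht, ← hX.expect_reflect 0
    (f := fun x => spinAt 0 1 x * spinAt (-1) 0 x * spinAt 2 b x * noCar 1 x)
    ((((bddLocal_spinAt 0 1).mul (bddLocal_spinAt (-1) 0)).mul (bddLocal_spinAt 2 b)).mul
      (bddLocal_noCar 1)).1
    (fun x => abs_mul_le_one (abs_mul_le_one (abs_mul_le_one (abs_spinAt_le _ _ _)
      (abs_spinAt_le _ _ _)) (abs_spinAt_le _ _ _)) (abs_noCar_le _ _)) ht]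
  simp only [spinAt_relabel, noCar_relabel, zero_sub, neg_zero, neg_neg]

end IsScreeningProcess

/-! ### The differential equations -/

theorem hasDerivWithinAt_of_exp_mul {u v : ℝ → ℝ} {d t : ℝ}
    (huv : ∀ t, 0 ≤ t → u t = Real.exp (-t) * v t)
    (hu : HasDerivWithinAt u d (Ici 0) t) (ht : 0 ≤ t) :
    HasDerivWithinAt v (v t + Real.exp t * d) (Ici 0) t := by
  have hv : ∀ t, 0 ≤ t → v t = Real.exp t * u t := fun t ht => by
    rw [huv t ht, ← mul_assoc, ← Real.exp_add, add_neg_cancel, Real.exp_zero, one_mul]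
  refine (((Real.hasDerivAt_exp t).hasDerivWithinAt.mul hu).congr (fun s hs => hv s hs)
    (hv t ht)).congr_deriv ?_
  rw [hv t ht]

theorem exp_mul_exp_neg (t : ℝ) : Real.exp t * Real.exp (-t) = 1 := by
  rw [← Real.exp_add, add_neg_cancel, Real.exp_zero]

theorem spinAt_emptyConfig (k : ℤ) (s : Spin) :
    spinAt k s emptyConfig = if s = 0 then 1 else 0 := by
  simp [spinAt, emptyConfig, eq_comm]

theorem bddLocal_both_sides (a b : Spin) :
    BddLocal fun x => spinAt (-1) a x * spinAt 1 b x * noCar 0 x :=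
  ((bddLocal_spinAt _ _).mul (bddLocal_spinAt _ _)).mul (bddLocal_noCar _)

theorem bddLocal_pattern (j k l : ℤ) (a b d : Spin) :
    BddLocal fun x => spinAt j a x * spinAt k b x * spinAt l d x :=
  ((bddLocal_spinAt _ _).mul (bddLocal_spinAt _ _)).mul (bddLocal_spinAt _ _)

namespace IsScreeningProcess

variable {Ω : Type*} {mΩ : MeasurableSpace Ω} {P : Measure Ω} [IsProbabilityMeasure P]
  {ℱ : Filtration ℝ≥0 mΩ} {X : ℝ≥0 → Ω → Config}

theorem hasDerivWithinAt_D (hX : IsScreeningProcess P ℱ X) (s : Spin) {t : ℝ}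
    (ht : 0 ≤ t) : HasDerivWithinAt (D P X s)
      (expect P X (fun x => spinAt 0 s (arrive 0 x) - spinAt 0 s x) t) (Ici 0) t := by
  rw [funext (hX.D_eq_expect s)]
  have hb := bddLocal_spinAt 0 s
  refine (hX.hasDerivWithinAt_expect hb ht).congr_deriv ?_
  rw [hX.expect_generatorSc (dependsOnVertices_spinAt (Finset.mem_singleton_self 0) s) hb,
    Finset.sum_singleton, hX.expect_sub (hb.comp_arrive 0) hb]

theorem hasDerivWithinAt_D_zero (hX : IsScreeningProcess P ℱ X) {t : ℝ} (ht : 0 ≤ t) :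
    HasDerivWithinAt (D P X 0) (-(f P X 0 t + f P X 1 t) ^ 2 * Real.exp (-t)) (Ici 0) t := by
  refine (hX.hasDerivWithinAt_D 0 ht).congr_deriv ?_
  -- A vacant vertex is filled exactly when both neighbours are in states `0` or `1`; regularity
  -- then gives that it has had no arrival.
  have h : expect P X (fun x => spinAt 0 0 (arrive 0 x) - spinAt 0 0 x) t =
      expect P X (fun x => -((spinAt (-1) 0 x * spinAt 1 0 x * noCar 0 x +
        spinAt (-1) 0 x * spinAt 1 1 x * noCar 0 x) + (spinAt (-1) 1 x * spinAt 1 0 x * noCar 0 x +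
        spinAt (-1) 1 x * spinAt 1 1 x * noCar 0 x))) t := by
    refine hX.expect_congr (fun x hx => ?_) t
    have h0 := hx 0
    simp only [spinAt, noCar, arrive_fst_self, nextSpin, zero_sub, zero_add] at h0 ⊢
    grind
  have hneg : ∀ g, expect P X (fun x => -g x) t = -expect P X g t := fun g => integral_neg _
  rw [h, hneg, hX.expect_add ((bddLocal_both_sides 0 0).add (bddLocal_both_sides 0 1))
    ((bddLocal_both_sides 1 0).add (bddLocal_both_sides 1 1)),
    hX.expect_add (bddLocal_both_sides 0 0) (bddLocal_both_sides 0 1),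
    hX.expect_add (bddLocal_both_sides 1 0) (bddLocal_both_sides 1 1)]
  simp only [hX.expect_both_sides _ _ ht]
  ring

theorem hasDerivWithinAt_D_one (hX : IsScreeningProcess P ℱ X) {t : ℝ} (ht : 0 ≤ t) :
    HasDerivWithinAt (D P X 1) (f P X 0 t ^ 2 * Real.exp (-t) - D₃ P X 0 1 0 t) (Ici 0) t := by
  refine (hX.hasDerivWithinAt_D 1 ht).congr_deriv ?_
  have h : expect P X (fun x => spinAt 0 1 (arrive 0 x) - spinAt 0 1 x) t =
      expect P X (fun x => spinAt (-1) 0 x * spinAt 1 0 x * noCar 0 x -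
        spinAt (-1) 0 x * spinAt 0 1 x * spinAt 1 0 x) t := by
    refine hX.expect_congr (fun x hx => ?_) t
    have h0 := hx 0
    simp only [spinAt, noCar, arrive_fst_self, nextSpin, zero_sub, zero_add] at h0 ⊢
    grind
  rw [h, hX.expect_sub (bddLocal_both_sides 0 0) (bddLocal_pattern _ _ _ _ _ _),
    hX.expect_both_sides _ _ ht, hX.D₃_eq_expect]
  ring

theorem hasDerivWithinAt_D_two (hX : IsScreeningProcess P ℱ X) {t : ℝ} (ht : 0 ≤ t) :
    HasDerivWithinAt (D P X 2)
      ((2 * f P X 0 t * f P X 1 t + f P X 1 t ^ 2) * Real.exp (-t)) (Ici 0) t := by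
  refine (hX.hasDerivWithinAt_D 2 ht).congr_deriv ?_
  have h : expect P X (fun x => spinAt 0 2 (arrive 0 x) - spinAt 0 2 x) t =
      expect P X (fun x => spinAt (-1) 0 x * spinAt 1 1 x * noCar 0 x +
        (spinAt (-1) 1 x * spinAt 1 0 x * noCar 0 x +
        spinAt (-1) 1 x * spinAt 1 1 x * noCar 0 x)) t := by
    refine hX.expect_congr (fun x hx => ?_) t
    have h0 := hx 0
    simp only [spinAt, noCar, arrive_fst_self, nextSpin, zero_sub, zero_add] at h0 ⊢
    grind
  rw [h, hX.expect_add (bddLocal_both_sides 0 1)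
    ((bddLocal_both_sides 1 0).add (bddLocal_both_sides 1 1)),
    hX.expect_add (bddLocal_both_sides 1 0) (bddLocal_both_sides 1 1)]
  simp only [hX.expect_both_sides _ _ ht]
  ring

theorem hasDerivWithinAt_D_three (hX : IsScreeningProcess P ℱ X) {t : ℝ} (ht : 0 ≤ t) :
    HasDerivWithinAt (D P X 3) (D₃ P X 0 1 0 t) (Ici 0) t := by
  refine (hX.hasDerivWithinAt_D 3 ht).congr_deriv ?_
  rw [hX.D₃_eq_expect]
  refine hX.expect_congr (fun x hx => ?_) t
  simp only [spinAt, arrive_fst_self, nextSpin, zero_sub, zero_add]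
  grind

theorem bddLocal_noCar_spinAt_noCar (j k l : ℤ) (s : Spin) :
    BddLocal fun x => noCar j x * spinAt k s x * noCar l x :=
  ((bddLocal_noCar _).mul (bddLocal_spinAt _ _)).mul (bddLocal_noCar _)

/-- Passing to the conditional probability multiplies by `exp t`, whose derivative cancels the loss
from arrivals at `0`; only arrivals at `1` remain. -/
theorem hasDerivWithinAt_f (hX : IsScreeningProcess P ℱ X) (s : Spin) {t d : ℝ} (ht : 0 ≤ t)
    (hd : expect P X (fun x => spinAt 1 s (arrive 1 x) * noCar 0 x) t -
      Real.exp (-t) * f P X s t = Real.exp (-t) * d) :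
    HasDerivWithinAt (f P X s) d (Ici 0) t := by
  have h := hX.hasDerivWithinAt_expect_mul_noCar 0 (bddLocal_spinAt 1 s)
    (dependsOnVertices_spinAt (Finset.mem_singleton_self _) _) ht
  refine (hasDerivWithinAt_of_exp_mul (fun t ht => hX.expect_eq_exp_mul_f s ht) h
    ht).congr_deriv ?_
  rw [Finset.erase_eq_of_notMem (by simp), Finset.sum_singleton, hX.expect_eq_exp_mul_f s ht, hd]
  linear_combination (d - f P X s t) * exp_mul_exp_neg t

theorem hasDerivWithinAt_f_zero (hX : IsScreeningProcess P ℱ X) {t : ℝ} (ht : 0 ≤ t) :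
    HasDerivWithinAt (f P X 0) (-(f P X 0 t) * Real.exp (-t) - f P X 1 t * Real.exp (-t))
      (Ici 0) t := by
  refine hX.hasDerivWithinAt_f 0 ht ?_
  -- Without arrivals the vertex `0` is vacant, so the state of `2` alone decides whether a car can
  -- park at a vacant `1`.
  have h : expect P X (fun x => spinAt 1 0 (arrive 1 x) * noCar 0 x) t =
      expect P X (fun x => spinAt 1 0 x * noCar 0 x - (noCar 0 x * spinAt 2 0 x * noCar 1 x +
        noCar 0 x * spinAt 2 1 x * noCar 1 x)) t := by
    refine hX.expect_congr (fun x hx => ?_) t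
    have h0 := hx 0
    have h1 := hx 1
    simp only [spinAt, noCar, arrive_fst_self, nextSpin, sub_self, zero_sub, zero_add,
      one_add_one_eq_two] at h0 h1 ⊢
    grind
  rw [h, hX.expect_sub ((bddLocal_spinAt 1 0).mul (bddLocal_noCar 0))
    ((bddLocal_noCar_spinAt_noCar 0 2 1 0).add (bddLocal_noCar_spinAt_noCar 0 2 1 1)),
    hX.expect_add (bddLocal_noCar_spinAt_noCar 0 2 1 0) (bddLocal_noCar_spinAt_noCar 0 2 1 1),
    hX.expect_two_noCar_right 0 ht, hX.expect_two_noCar_right 1 ht, hX.expect_eq_exp_mul_f 0 ht]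
  ring

theorem hasDerivWithinAt_f_one (hX : IsScreeningProcess P ℱ X) {t : ℝ} (ht : 0 ≤ t) :
    HasDerivWithinAt (f P X 1) (f P X 0 t * Real.exp (-t) - R P X t) (Ici 0) t := by
  refine hX.hasDerivWithinAt_f 1 ht ?_
  have hb : BddLocal fun x => spinAt 1 1 x * spinAt 2 0 x * noCar 0 x :=
    ((bddLocal_spinAt _ _).mul (bddLocal_spinAt _ _)).mul (bddLocal_noCar _)
  have hb' := (bddLocal_spinAt 1 1).mul (bddLocal_noCar 0)
  have h : expect P X (fun x => spinAt 1 1 (arrive 1 x) * noCar 0 x) t =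
      expect P X (fun x => spinAt 1 1 x * noCar 0 x + (noCar 0 x * spinAt 2 0 x * noCar 1 x -
        spinAt 1 1 x * spinAt 2 0 x * noCar 0 x)) t := by
    refine hX.expect_congr (fun x hx => ?_) t
    have h0 := hx 0
    have h1 := hx 1
    simp only [spinAt, noCar, arrive_fst_self, nextSpin, sub_self, zero_sub, zero_add,
      one_add_one_eq_two] at h0 h1 ⊢
    grind
  rw [h, hX.expect_add hb' ((bddLocal_noCar_spinAt_noCar 0 2 1 0).sub hb),
    hX.expect_sub (bddLocal_noCar_spinAt_noCar 0 2 1 0) hb,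
    hX.expect_two_noCar_right 0 ht, hX.expect_eq_exp_mul_R ht, hX.expect_eq_exp_mul_f 1 ht]
  ring

theorem hasDerivWithinAt_f_two (hX : IsScreeningProcess P ℱ X) {t : ℝ} (ht : 0 ≤ t) :
    HasDerivWithinAt (f P X 2) (f P X 1 t * Real.exp (-t)) (Ici 0) t := by
  refine hX.hasDerivWithinAt_f 2 ht ?_
  have h : expect P X (fun x => spinAt 1 2 (arrive 1 x) * noCar 0 x) t =
      expect P X (fun x => spinAt 1 2 x * noCar 0 x + noCar 0 x * spinAt 2 1 x * noCar 1 x) t := by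
    refine hX.expect_congr (fun x hx => ?_) t
    have h0 := hx 0
    have h1 := hx 1
    simp only [spinAt, noCar, arrive_fst_self, nextSpin, sub_self, zero_sub, zero_add,
      one_add_one_eq_two] at h0 h1 ⊢
    grind
  rw [h, hX.expect_add ((bddLocal_spinAt 1 2).mul (bddLocal_noCar 0))
    (bddLocal_noCar_spinAt_noCar 0 2 1 1),
    hX.expect_two_noCar_right 1 ht, hX.expect_eq_exp_mul_f 2 ht]
  ring

theorem hasDerivWithinAt_R (hX : IsScreeningProcess P ℱ X) {t : ℝ} (ht : 0 ≤ t) :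
    HasDerivWithinAt (R P X)
      (f P X 0 t * (Real.exp (-t) - t * Real.exp (-2 * t)) - f P X 1 t * t * Real.exp (-2 * t) -
        R P X t) (Ici 0) t := by
  have hb := (bddLocal_spinAt 1 1).mul (bddLocal_spinAt 2 0)
  have hΛ : DependsOnVertices {1, 2} fun x => spinAt 1 1 x * spinAt 2 0 x :=
    (dependsOnVertices_spinAt (by simp) 1).mul (dependsOnVertices_spinAt (by simp) 0)
  have h := hX.hasDerivWithinAt_expect_mul_noCar 0 hb hΛ ht
  -- An arrival at `1` always destroys the pattern, by parking in the second line, and creates it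
  -- from a vertex `1` without arrivals.
  have h1 : expect P X (fun x => spinAt 1 1 (arrive 1 x) * spinAt 2 0 (arrive 1 x) * noCar 0 x) t =
      expect P X (fun x => noCar 0 x * spinAt 2 0 x * noCar 1 x) t := by
    refine hX.expect_congr (fun x hx => ?_) t
    have h0 := hx 0
    have h1 := hx 1
    have h2 : (arrive 1 x).1 2 = x.1 2 := arrive_fst_of_ne (by simp) x
    simp only [spinAt, noCar, arrive_fst_self, nextSpin, sub_self, zero_sub, zero_add,
      one_add_one_eq_two, h2] at h0 h1 ⊢
    grind
  have hc : ∀ s, BddLocal fun x => spinAt 1 1 x * noCar 0 x * spinAt 3 s x * noCar 2 x := fun s =>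
    (((bddLocal_spinAt _ _).mul (bddLocal_noCar _)).mul (bddLocal_spinAt _ _)).mul
      (bddLocal_noCar _)
  -- An arrival at `2` destroys the pattern unless `3` is occupied in the second line. Then no car
  -- had arrived at `0` and `2`, which is the source of the factor `t`.
  have h2 : expect P X (fun x => spinAt 1 1 (arrive 2 x) * spinAt 2 0 (arrive 2 x) * noCar 0 x) t =
      expect P X (fun x => spinAt 1 1 x * spinAt 2 0 x * noCar 0 x -
        (spinAt 1 1 x * noCar 0 x * spinAt 3 0 x * noCar 2 x +
          spinAt 1 1 x * noCar 0 x * spinAt 3 1 x * noCar 2 x)) t := by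
    refine hX.expect_congr (fun x hx => ?_) t
    have h2 := hx 2
    have h1 : (arrive 2 x).1 1 = x.1 1 := arrive_fst_of_ne (by simp) x
    simp only [spinAt, noCar, arrive_fst_self, nextSpin, h1, show (2 : ℤ) - 1 = 1 from rfl,
      two_add_one_eq_three] at h2 ⊢
    grind
  rw [Finset.erase_eq_of_notMem (by simp), Finset.sum_pair (by simp), h1, h2,
    hX.expect_sub (hb.mul (bddLocal_noCar 0)) ((hc 0).add (hc 1)), hX.expect_add (hc 0) (hc 1),
    hX.expect_two_noCar_right 0 ht, hX.expect_noCar_one_noCar_right 0 ht,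
    hX.expect_noCar_one_noCar_right 1 ht, hX.expect_eq_exp_mul_R ht] at h
  refine (hasDerivWithinAt_of_exp_mul (fun t ht => hX.expect_eq_exp_mul_R ht) h
    ht).congr_deriv ?_
  rw [neg_mul, exp_neg_two_mul]
  linear_combination (f P X 0 t * Real.exp (-t) - 2 * R P X t -
    t * Real.exp (-t) ^ 2 * (f P X 0 t + f P X 1 t)) * exp_mul_exp_neg t

theorem hasDerivWithinAt_D₃ (hX : IsScreeningProcess P ℱ X) {t : ℝ} (ht : 0 ≤ t) :
    HasDerivWithinAt (D₃ P X 0 1 0)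
      (f P X 0 t ^ 2 * Real.exp (-t) - D₃ P X 0 1 0 t - 2 * R P X t * f P X 0 t * Real.exp (-t) -
        2 * R P X t * f P X 1 t * Real.exp (-t)) (Ici 0) t := by
  have hb := bddLocal_pattern (-1) 0 1 0 1 0
  have hΛ : DependsOnVertices {-1, 0, 1} fun x => spinAt (-1) 0 x * spinAt 0 1 x * spinAt 1 0 x :=
    ((dependsOnVertices_spinAt (by simp) 0).mul (dependsOnVertices_spinAt (by simp) 1)).mul
      (dependsOnVertices_spinAt (by simp) 0)
  rw [funext (hX.D₃_eq_expect 0 1 0)]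
  have h := hX.hasDerivWithinAt_expect hb ht
  rw [hX.expect_generatorSc hΛ hb, Finset.sum_insert (by simp), Finset.sum_pair (by simp)] at h
  have hl : ∀ s, BddLocal fun x =>
      spinAt 0 1 x * spinAt 1 0 x * spinAt (-2) s x * noCar (-1) x := fun s =>
    (bddLocal_pattern _ _ _ _ _ _).mul (bddLocal_noCar _)
  have hr : ∀ s, BddLocal fun x =>
      spinAt 0 1 x * spinAt (-1) 0 x * spinAt 2 s x * noCar 1 x := fun s =>
    (bddLocal_pattern _ _ _ _ _ _).mul (bddLocal_noCar _)
  -- The left end of the pattern is filled exactly when `-2` is in state `0` or `1`; then `-1` has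
  -- had no arrival and separates `-2` from the rest of the pattern.
  have h1 : expect P X (fun x => spinAt (-1) 0 (arrive (-1) x) * spinAt 0 1 (arrive (-1) x) *
        spinAt 1 0 (arrive (-1) x)) t =
      expect P X (fun x => spinAt (-1) 0 x * spinAt 0 1 x * spinAt 1 0 x -
        (spinAt 0 1 x * spinAt 1 0 x * spinAt (-2) 0 x * noCar (-1) x +
          spinAt 0 1 x * spinAt 1 0 x * spinAt (-2) 1 x * noCar (-1) x)) t := by
    refine hX.expect_congr (fun x hx => ?_) t
    have h1 := hx (-1)
    have ha : (arrive (-1) x).1 0 = x.1 0 := arrive_fst_of_ne (by simp) x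
    have hb : (arrive (-1) x).1 1 = x.1 1 := arrive_fst_of_ne (by simp) x
    simp only [spinAt, noCar, arrive_fst_self, nextSpin, ha, hb, show (-1 : ℤ) - 1 = -2 from rfl,
      neg_add_cancel] at h1 ⊢
    grind
  -- An arrival at the centre turns an existing pattern into `(0, 3, 0)`, so afterwards the pattern
  -- is present only if the centre had no arrival before.
  have h2 : expect P X (fun x => spinAt (-1) 0 (arrive 0 x) * spinAt 0 1 (arrive 0 x) *
        spinAt 1 0 (arrive 0 x)) t =
      expect P X (fun x => spinAt (-1) 0 x * spinAt 1 0 x * noCar 0 x) t := by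
    refine hX.expect_congr (fun x hx => ?_) t
    have h0 := hx 0
    have ha : (arrive 0 x).1 (-1) = x.1 (-1) := arrive_fst_of_ne (by simp) x
    have hb : (arrive 0 x).1 1 = x.1 1 := arrive_fst_of_ne (by simp) x
    simp only [spinAt, noCar, arrive_fst_self, nextSpin, ha, hb, zero_sub, zero_add] at h0 ⊢
    grind
  have h3 : expect P X (fun x => spinAt (-1) 0 (arrive 1 x) * spinAt 0 1 (arrive 1 x) *
        spinAt 1 0 (arrive 1 x)) t =
      expect P X (fun x => spinAt (-1) 0 x * spinAt 0 1 x * spinAt 1 0 x -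
        (spinAt 0 1 x * spinAt (-1) 0 x * spinAt 2 0 x * noCar 1 x +
          spinAt 0 1 x * spinAt (-1) 0 x * spinAt 2 1 x * noCar 1 x)) t := by
    refine hX.expect_congr (fun x hx => ?_) t
    have h1 := hx 1
    have ha : (arrive 1 x).1 0 = x.1 0 := arrive_fst_of_ne (by simp) x
    have hb : (arrive 1 x).1 (-1) = x.1 (-1) := arrive_fst_of_ne (by simp) x
    simp only [spinAt, noCar, arrive_fst_self, nextSpin, ha, hb, sub_self,
      one_add_one_eq_two] at h1 ⊢
    grind
  rw [h1, h2, h3, hX.expect_sub hb ((hl 0).add (hl 1)), hX.expect_sub hb ((hr 0).add (hr 1)),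
    hX.expect_add (hl 0) (hl 1), hX.expect_add (hr 0) (hr 1), hX.expect_both_sides 0 0 ht,
    hX.expect_one_zero_left 0 ht, hX.expect_one_zero_left 1 ht, hX.expect_one_zero_right 0 ht,
    hX.expect_one_zero_right 1 ht] at h
  exact h.congr_deriv (by ring)

theorem D_at_zero (hX : IsScreeningProcess P ℱ X) (s : Spin) :
    D P X s 0 = if s = 0 then 1 else 0 := by
  rw [hX.D_eq_expect, hX.expect_zero (bddLocal_spinAt 0 s), spinAt_emptyConfig]

theorem D₃_at_zero (hX : IsScreeningProcess P ℱ X) : D₃ P X 0 1 0 0 = 0 := by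
  rw [hX.D₃_eq_expect, hX.expect_zero (bddLocal_pattern _ _ _ _ _ _)]
  simp [spinAt_emptyConfig]

theorem f_at_zero (hX : IsScreeningProcess P ℱ X) (s : Spin) :
    f P X s 0 = if s = 0 then 1 else 0 := by
  have h := hX.expect_eq_exp_mul_f s le_rfl
  rw [hX.expect_zero ((bddLocal_spinAt 1 s).mul (bddLocal_noCar 0)), spinAt_emptyConfig,
    noCar_emptyConfig, neg_zero, Real.exp_zero, one_mul, mul_one] at h
  exact h.symm

theorem R_at_zero (hX : IsScreeningProcess P ℱ X) : R P X 0 = 0 := by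
  have h := hX.expect_eq_exp_mul_R le_rfl
  rw [hX.expect_zero (((bddLocal_spinAt 1 1).mul (bddLocal_spinAt 2 0)).mul (bddLocal_noCar 0)),
    spinAt_emptyConfig, neg_zero, Real.exp_zero, one_mul] at h
  simpa using h.symm

end IsScreeningProcess

end Parking

theorem theorem2 {Ω : Type*} {mΩ : MeasurableSpace Ω} (P : Measure Ω) [IsProbabilityMeasure P]
    (ℱ : Filtration ℝ≥0 mΩ) (X : ℝ≥0 → Ω → Parking.Config)
    (hX : Parking.IsScreeningProcess P ℱ X)
    (D : Parking.Spin → ℝ → ℝ) (hD : D = Parking.D P X)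
    (D010 : ℝ → ℝ) (hD010 : D010 = Parking.D₃ P X 0 1 0)
    (f : Parking.Spin → ℝ → ℝ) (hf : f = Parking.f P X)
    (R : ℝ → ℝ) (hR : R = Parking.R P X) :
    -- the densities of a single vertex
    (∀ t : ℝ, 0 ≤ t →
      HasDerivWithinAt (D 0) (-(f 0 t + f 1 t) ^ 2 * Real.exp (-t)) (Ici 0) t ∧
      HasDerivWithinAt (D 1) (f 0 t ^ 2 * Real.exp (-t) - D010 t) (Ici 0) t ∧
      HasDerivWithinAt (D 2) ((2 * f 0 t * f 1 t + f 1 t ^ 2) * Real.exp (-t)) (Ici 0) t ∧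
      HasDerivWithinAt (D 3) (D010 t) (Ici 0) t) ∧
    (D 0 0 = 1 ∧ D 1 0 = 0 ∧ D 2 0 = 0 ∧ D 3 0 = 0) ∧
    -- the one-sided densities
    (∀ t : ℝ, 0 ≤ t →
      HasDerivWithinAt (f 0) (-(f 0 t) * Real.exp (-t) - f 1 t * Real.exp (-t)) (Ici 0) t ∧
      HasDerivWithinAt (f 1) (f 0 t * Real.exp (-t) - R t) (Ici 0) t ∧
      HasDerivWithinAt (f 2) (f 1 t * Real.exp (-t)) (Ici 0) t ∧
      HasDerivWithinAt R
        (f 0 t * (Real.exp (-t) - t * Real.exp (-2 * t)) - f 1 t * t * Real.exp (-2 * t) - R t)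
        (Ici 0) t) ∧
    (f 0 0 = 1 ∧ f 1 0 = 0 ∧ f 2 0 = 0 ∧ R 0 = 0) ∧
    -- the density of the pattern `(0, 1, 0)`
    (∀ t : ℝ, 0 ≤ t →
      HasDerivWithinAt D010
        (f 0 t ^ 2 * Real.exp (-t) - D010 t - 2 * R t * f 0 t * Real.exp (-t)
          - 2 * R t * f 1 t * Real.exp (-t)) (Ici 0) t) ∧
    D010 0 = 0 := by
  subst hD hD010 hf hR
  refine ⟨fun t ht => ⟨hX.hasDerivWithinAt_D_zero ht, hX.hasDerivWithinAt_D_one ht,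
    hX.hasDerivWithinAt_D_two ht, hX.hasDerivWithinAt_D_three ht⟩, ?_,
    fun t ht => ⟨hX.hasDerivWithinAt_f_zero ht, hX.hasDerivWithinAt_f_one ht,
      hX.hasDerivWithinAt_f_two ht, hX.hasDerivWithinAt_R ht⟩, ?_,
    fun t ht => hX.hasDerivWithinAt_D₃ ht, hX.D₃_at_zero⟩
  · simp [hX.D_at_zero]
  · simp [hX.f_at_zero, hX.R_at_zero]
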